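/- Let $f\ge 1$ be an integer and $s\ge 1$ a real number. There are $m=2f$ machines, partitioned into two groups $M_1,M_2$ of $f$ machines each. A job $j$ is given by a real number $p_j>0$ and a favorite group, which is $M_1$ or $M_2$: its processing time is $p_j$ on each machine of its favorite group and $s\,p_j$ on each machine of the other group. Jobs arrive one by one and each has to be assigned irrevocably to a machine on arrival. The load of a machine is the sum of the processing times of the jobs assigned to it, and the makespan of an assignment is the maximum load over all machines. The algorithm Greedy assigns every job to a machine that minimizes the completion time of this job (the load of the machine after the job has been assigned to it); ties may be broken by any rule. Let $$\rho_{\mathrm{Greedy}}=\sup_I \frac{C_{\mathrm{Greedy}}(I)}{C_{\mathrm{opt}}(I)}$$ be its competitive ratio, where $I$ ranges over all finite nonempty sequences of jobs, $C_{\mathrm{Greedy}}(I)$ is the makespan that Greedy produces on $I$, and $C_{\mathrm{opt}}(I)$ is the minimum makespan over all assignments of the jobs of $I$. Let $$\hat\rho_{\mathrm{Greedy}}=\min\left\{1+\Big(2-\frac1f\Big)\frac{s^2}{s+1},\ \ s+\Big(2-\frac1f\Big)\frac{s}{s+1},\ \ 3-\frac1f\right\}.$$ Then $\rho_{\mathrm{Greedy}}=\hat\rho_{\mathrm{Greedy}}$,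 whatever the tie-breaking rule, in each of the following cases, with the following values (where $\frac{s}{s-1}$ is read as $+\infty$ if $s=1$): 1. for $f=1$, $\rho_{\mathrm{Greedy}}=\min\left\{1+\frac{s^2}{s+1},\,2\right\}$; 2. for $f=2$ and $1\le s\le 1.605$, $\rho_{\mathrm{Greedy}}=1+\frac{3s^2}{2(s+1)}$; 3. for $3\le f\le\frac{s}{s-1}$ (which implies $1\le s\le 1.5$), $\rho_{\mathrm{Greedy}}=1+\left(2-\frac1f\right)\frac{s^2}{s+1}$; 4. for $f>\frac{s}{s-1}$ and $1\le s\le\frac{1+\sqrt5}{2}$, $\rho_{\mathrm{Greedy}}=s+\left(2-\frac1f\right)\frac{s}{s+1}$; 5. for $2\le f<s$, $\rho_{\mathrm{Greedy}}=3-\frac1f$. -/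

import Mathlib

namespace SymmetricFavorite

/-- The `2 f` machines, in two groups of `f` machines each:
the machines `(0, _)` form the group `M₁` and the machines `(1, _)` form the group `M₂`. -/
abbrev Machine (f : ℕ) : Type := Fin 2 × Fin f

/-- A job: its minimum processing time, and the group of machines that is its favorite one. -/
structure Job where
  size : ℝ
  size_pos : 0 < size
  fav : Fin 2

/-- The processing time of job `j` on machine `i`: the minimum processing time if `i` belongs
to the favorite group of `j`, and `s` times as much otherwise. -/
noncomputable def procTime {f : ℕ} (s : ℝ) (j : Job) (i : Machine f) : ℝ :=
  if i.1 = j.fav then j.size else s * j.size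

/-- The load of machine `i` when the `k`-th job of the sequence `I` is put on machine `σ k`. -/
noncomputable def load {f : ℕ} (s : ℝ) (I : List Job) (σ : Fin I.length → Machine f)
    (i : Machine f) : ℝ :=
  ∑ k, if σ k = i then procTime s (I.get k) i else 0

/-- The makespan of an allocation: the maximum load over all machines. -/
noncomputable def makespan {f : ℕ} (s : ℝ) (I : List Job) (σ : Fin I.length → Machine f) : ℝ :=
  ⨆ i, load s I σ i

/-- The optimal cost of a job sequence: the minimum makespan over all allocations. -/
noncomputable def optCost (f : ℕ) (s : ℝ) (I : List Job) : ℝ :=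
  ⨅ σ : Fin I.length → Machine f, makespan s I σ

/-- A deterministic online algorithm: it sends the list of the jobs that have already arrived,
and the current job, to the machine which the current job is put on. -/
abbrev OnlineAlg (f : ℕ) : Type := List Job → Job → Machine f

/-- The allocation of the job sequence `I` by the online algorithm `A`. -/
def OnlineAlg.run {f : ℕ} (A : OnlineAlg f) (I : List Job) : Fin I.length → Machine f :=
  fun k => A (I.take k) (I.get k)

/-- The cost (makespan) of the online algorithm `A` on the job sequence `I`. -/
noncomputable def OnlineAlg.cost {f : ℕ} (A : OnlineAlg f) (s : ℝ) (I : List Job) : ℝ :=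
  makespan s I (A.run I)

/-- `A` is a version of the Greedy algorithm: every job is put on a machine that minimizes the
completion time of this job. Ties may be broken in any way whatsoever. -/
def IsGreedy {f : ℕ} (s : ℝ) (A : OnlineAlg f) : Prop :=
  ∀ (h : List Job) (j : Job) (i : Machine f),
    load s h (A.run h) (A h j) + procTime s j (A h j) ≤ load s h (A.run h) i + procTime s j i

/-- `ρ` is the competitive ratio of `A`: the (finite) supremum, over all nonempty job sequences,
of the cost of `A` divided by the optimal cost. -/
def HasCompetitiveRatio {f : ℕ} (s : ℝ) (A : OnlineAlg f) (ρ : ℝ) : Prop :=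
  IsLUB {r : ℝ | ∃ I : List Job, I ≠ [] ∧ r = A.cost s I / optCost f s I} ρ

/-- The upper bound on the competitive ratio of the Greedy algorithm. -/
noncomputable def greedyBound (f : ℕ) (s : ℝ) : ℝ :=
  min (min (1 + (2 - 1 / (f : ℝ)) * (s ^ 2 / (s + 1)))
    (s + (2 - 1 / (f : ℝ)) * (s / (s + 1)))) (3 - 1 / (f : ℝ))

/-- The loads which an online algorithm produces satisfy the usual recursion. -/
theorem load_run_append {f : ℕ} (s : ℝ) (A : OnlineAlg f) (h : List Job) (j : Job)
    (i : Machine f) :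
    load s (h ++ [j]) (A.run (h ++ [j])) i =
      load s h (A.run h) i + if A h j = i then procTime s j i else 0 := by
  have e : (h ++ [j]).length = h.length + 1 := by simp
  unfold load OnlineAlg.run
  rw [← (finCongr e.symm).sum_comp, Fin.sum_univ_castSucc]
  congr 1
  · refine Finset.sum_congr rfl fun k _ => ?_
    have hk : (k : ℕ) ≤ h.length := k.2.le
    simp [List.take_append_of_le_length hk]
  · simp

/-- A version of the Greedy algorithm exists. -/
theorem exists_isGreedy {f : ℕ} (hf : 1 ≤ f) (s : ℝ) : ∃ A : OnlineAlg f, IsGreedy s A := by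
  have : NeZero f := ⟨by omega⟩
  have hmin : ∀ (L : Machine f → ℝ) (j : Job), ∃ m : Machine f, ∀ i,
      L m + procTime s j m ≤ L i + procTime s j i := fun L j => by
    obtain ⟨m, hm⟩ := Finite.exists_min (fun i : Machine f => L i + procTime s j i)
    exact ⟨m, hm⟩
  choose pick hpick using hmin
  let step : (Machine f → ℝ) → Job → (Machine f → ℝ) := fun L j i =>
    L i + if pick L j = i then procTime s j i else 0
  let A : OnlineAlg f := fun h j => pick (h.foldl step 0) j
  have key : ∀ h : List Job, load s h (A.run h) = h.foldl step 0 := by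
    intro h
    induction h using List.reverseRecOn with
    | nil => funext i; simp [load]
    | append_singleton h j ih =>
      funext i
      rw [load_run_append, ih, List.foldl_append]
      rfl
  refine ⟨A, fun h j i => ?_⟩
  rw [key h]
  exact hpick (h.foldl step 0) j i

end SymmetricFavorite

/-! Upper bound. Any makespan bounds the job sizes, the total volume, and the two weighted volumes
in which one favorite group counts `s` times (`isVolumeBound_makespan`). Greedy's completion time is
at most what every machine offers. Averaging these offers over both groups with weights `(1, s)` or
`(s, 1)` gives the first two terms of the minimum. The third comes from averaging over the favorite
group alone, since under Greedy any `f` machines carry at most the total volume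
(`IsGreedy.sum_runLoad_le`).

Lower bound. The constructions keep the loads within each group equal (`HasLevels`) and make all
relevant comparisons strict, so tie-breaking has no influence. If one group is ahead by `γ ^ (k +
1)`, then `f` jobs preferring it, of size `climbSize s γ k`, still go to the other group and put
that one ahead by `γ ^ k`; this works exactly for `γ > s - 1`. Such a climb starts from two common
levels produced by tiny jobs, nearly all on their wrong groups, and ends with a gap close to `s -
1`. A last job of size `1` preferring the higher group then finishes at nearly the same time on both
groups.

The optimum treats the tiny jobs as a fluid (`fits_of_size_le`) and frees one machine for the last
job. The initial level is chosen so that a weighted volume bound becomes tight, up to errors that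
vanish as `γ` tends to `s - 1`: with the optimum misplacing only jobs of the first group
(`IsGreedy.exists_jobs_of_few`) or only jobs of the second (`IsGreedy.exists_jobs_of_many`). Which
one is possible depends on the sign of `(f - 1) * s - f`. The cases `s = 1`, `f = 1` and `f < s`
have shorter sequences. -/

namespace SymmetricFavorite

/-! ### Volumes, loads, and lower bounds for a makespan -/

/-- The total size of the jobs of `I` whose favorite group is `c`. -/
noncomputable def volume (c : Fin 2) (I : List Job) : ℝ :=
  (I.map fun j => if j.fav = c then j.size else 0).sum

theorem volume_append (c : Fin 2) (I J : List Job) :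
    volume c (I ++ J) = volume c I + volume c J := by
  simp [volume]

theorem volume_replicate (c : Fin 2) (n : ℕ) (j : Job) :
    volume c (List.replicate n j) = n * (if j.fav = c then j.size else 0) := by
  simp only [volume, List.map_replicate, List.sum_replicate, nsmul_eq_mul]

theorem volume_singleton (c : Fin 2) (j : Job) :
    volume c [j] = if j.fav = c then j.size else 0 := by
  simp [volume]

theorem volume_nonneg (c : Fin 2) (I : List Job) : 0 ≤ volume c I := by
  refine List.sum_nonneg fun x hx => ?_
  obtain ⟨j, -, rfl⟩ := List.mem_map.1 hx
  split_ifs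
  · exact j.size_pos.le
  · exact le_rfl

/-- The slowdown of the jobs with favorite group `c` on the machines of group `g`. -/
noncomputable def slowdown (s : ℝ) (c g : Fin 2) : ℝ := if g = c then 1 else s

theorem procTime_eq {f : ℕ} (s : ℝ) (j : Job) (i : Machine f) :
    procTime s j i = slowdown s j.fav i.1 * j.size := by
  unfold procTime slowdown
  split_ifs <;> simp

theorem one_le_slowdown {s : ℝ} (hs : 1 ≤ s) (c g : Fin 2) : 1 ≤ slowdown s c g := by
  unfold slowdown
  split_ifs
  · exact le_rfl
  · exact hs

theorem size_le_procTime {f : ℕ} {s : ℝ} (hs : 1 ≤ s) (j : Job) (i : Machine f) :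
    j.size ≤ procTime s j i := by
  rw [procTime_eq]
  exact le_mul_of_one_le_left j.size_pos.le (one_le_slowdown hs _ _)

theorem procTime_pos {f : ℕ} {s : ℝ} (hs : 1 ≤ s) (j : Job) (i : Machine f) :
    0 < procTime s j i :=
  j.size_pos.trans_le (size_le_procTime hs j i)

theorem sum_mul_load {f : ℕ} (s : ℝ) (I : List Job) (σ : Fin I.length → Machine f)
    (w : Machine f → ℝ) :
    ∑ i, w i * load s I σ i = ∑ k, w (σ k) * procTime s (I.get k) (σ k) := by
  simp only [load, Finset.mul_sum]
  rw [Finset.sum_comm]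
  refine Finset.sum_congr rfl fun k _ => ?_
  simp

theorem sum_mul_volume (I : List Job) (v : Fin 2 → ℝ) :
    ∑ c, v c * volume c I = ∑ k : Fin I.length, v (I.get k).fav * (I.get k).size := by
  have h := Fin.sum_univ_fun_getElem I (fun j => v j.fav * j.size)
  simp only [List.get_eq_getElem]
  rw [h]
  clear h
  induction I with
  | nil => simp [volume]
  | cons j I ih =>
    rw [List.map_cons, List.sum_cons, ← ih]
    simp only [volume, List.map_cons, List.sum_cons, mul_add, Finset.sum_add_distrib]
    simp

/-- Weak duality: `w` prices machine time and `v` prices job volume. If no job is worth more than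
the machine time it takes anywhere, the same holds for the totals. -/
theorem sum_mul_volume_le {f : ℕ} {s : ℝ} (I : List Job) (σ : Fin I.length → Machine f)
    {v w : Fin 2 → ℝ} (h : ∀ c g, v c ≤ w g * slowdown s c g) :
    ∑ c, v c * volume c I ≤ ∑ i : Machine f, w i.1 * load s I σ i := by
  rw [sum_mul_volume, sum_mul_load s I σ fun i => w i.1]
  refine Finset.sum_le_sum fun k _ => ?_
  rw [procTime_eq, ← mul_assoc]
  exact mul_le_mul_of_nonneg_right (h _ _) (I.get k).size_pos.le

theorem sum_mul_load_le {f : ℕ} {s : ℝ} (I : List Job) (σ : Fin I.length → Machine f)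
    {v w : Fin 2 → ℝ} (h : ∀ c g, w g * slowdown s c g ≤ v c) :
    ∑ i : Machine f, w i.1 * load s I σ i ≤ ∑ c, v c * volume c I := by
  rw [sum_mul_volume, sum_mul_load s I σ fun i => w i.1]
  refine Finset.sum_le_sum fun k _ => ?_
  rw [procTime_eq, ← mul_assoc]
  exact mul_le_mul_of_nonneg_right (h _ _) (I.get k).size_pos.le

theorem load_nonneg {f : ℕ} {s : ℝ} (hs : 1 ≤ s) (I : List Job) (σ : Fin I.length → Machine f)
    (i : Machine f) : 0 ≤ load s I σ i := by
  refine Finset.sum_nonneg fun k _ => ?_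
  split_ifs
  · exact (procTime_pos hs _ _).le
  · exact le_rfl

theorem load_le_makespan {f : ℕ} (s : ℝ) (I : List Job) (σ : Fin I.length → Machine f)
    (i : Machine f) : load s I σ i ≤ makespan s I σ :=
  le_ciSup (Set.finite_range _).bddAbove i

theorem size_le_makespan {f : ℕ} {s : ℝ} (hs : 1 ≤ s) (I : List Job)
    (σ : Fin I.length → Machine f) {j : Job} (hj : j ∈ I) : j.size ≤ makespan s I σ := by
  obtain ⟨k, rfl⟩ := List.get_of_mem hj
  refine (size_le_procTime hs _ (σ k)).trans (le_trans ?_ (load_le_makespan s I σ (σ k)))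
  have h := Finset.single_le_sum
    (f := fun l => if σ l = σ k then procTime s (I.get l) (σ k) else 0) (fun l _ => by
      split_ifs
      · exact (procTime_pos hs _ _).le
      · exact le_rfl) (Finset.mem_univ k)
  simpa [load] using h

/-- The inequalities by which a makespan `T` of the jobs of `I` is bounded from below. -/
structure IsVolumeBound (f : ℕ) (s : ℝ) (I : List Job) (T : ℝ) : Prop where
  size_le : ∀ j ∈ I, j.size ≤ T
  volume_add_le : volume 0 I + volume 1 I ≤ 2 * f * T
  mul_volume_add_le : ∀ c d : Fin 2, c ≠ d → s * volume c I + volume d I ≤ f * (s + 1) * T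

theorem isVolumeBound_makespan {f : ℕ} {s : ℝ} (hs : 1 ≤ s) (I : List Job)
    (σ : Fin I.length → Machine f) : IsVolumeBound f s I (makespan s I σ) := by
  have key : ∀ v w : Fin 2 → ℝ, (∀ g, 0 ≤ w g) → (∀ c g, v c ≤ w g * slowdown s c g) →
      ∑ c, v c * volume c I ≤ f * (w 0 + w 1) * makespan s I σ := by
    intro v w hw h
    refine (sum_mul_volume_le I σ h).trans ?_
    refine (Finset.sum_le_sum (g := fun i : Machine f => w i.1 * makespan s I σ) fun i _ =>
      mul_le_mul_of_nonneg_left (load_le_makespan s I σ i) (hw _)).trans (le_of_eq ?_)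
    rw [Fintype.sum_prod_type]
    simp only [Finset.sum_const, Finset.card_univ, Fintype.card_fin, nsmul_eq_mul,
      Fin.sum_univ_two]
    ring
  refine ⟨fun j hj => size_le_makespan hs I σ hj, ?_, fun c d hcd => ?_⟩
  · have h := key (fun _ => 1) (fun _ => 1) (fun _ => zero_le_one) fun c g => by
      simpa using one_le_slowdown hs c g
    simp only [Fin.sum_univ_two, one_mul] at h
    linarith
  -- With price `s` on group `c` and `1` on group `d`, a job favoring `c` costs `s` times its size
  -- on either group, and a job favoring `d` costs at least its size.
  · have h := key (fun e => if e = c then s else 1) (fun e => if e = c then s else 1)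
      (fun g => by split_ifs <;> linarith) fun e g => by
        unfold slowdown
        have : e = c ∨ e = d := by omega
        have : g = c ∨ g = d := by omega
        rcases this with rfl | rfl <;> rcases ‹e = _ ∨ e = _› with rfl | rfl <;>
          simp_all [hcd.symm] <;> nlinarith
    simp only [Fin.sum_univ_two] at h
    have hc : (c = 0 ∧ d = 1) ∨ (c = 1 ∧ d = 0) := by omega
    rcases hc with ⟨rfl, rfl⟩ | ⟨rfl, rfl⟩ <;> simp at h <;> linarith

theorem IsVolumeBound.pos {f : ℕ} {s T : ℝ} {I : List Job} (hI : I ≠ [])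
    (h : IsVolumeBound f s I T) : 0 < T :=
  (I.head hI).size_pos.trans_le (h.size_le _ (List.head_mem hI))

theorem IsVolumeBound.of_append {f : ℕ} {s T : ℝ} (hs : 1 ≤ s) {I J : List Job}
    (h : IsVolumeBound f s (I ++ J) T) : IsVolumeBound f s I T := by
  have h0 := volume_nonneg 0 J
  have h1 := volume_nonneg 1 J
  refine ⟨fun j hj => h.size_le j (by simp [hj]), ?_, fun c d hcd => ?_⟩
  · have := h.volume_add_le
    simp only [volume_append] at this
    linarith
  · have := h.mul_volume_add_le c d hcd
    simp only [volume_append] at this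
    have hc := volume_nonneg c J
    have hd := volume_nonneg d J
    nlinarith

/-- The load of machine `i` after the algorithm `A` has treated the jobs of `h`. -/
noncomputable def OnlineAlg.runLoad {f : ℕ} (A : OnlineAlg f) (s : ℝ) (h : List Job)
    (i : Machine f) : ℝ :=
  load s h (A.run h) i

theorem runLoad_nil {f : ℕ} (A : OnlineAlg f) (s : ℝ) (i : Machine f) : A.runLoad s [] i = 0 := by
  simp [OnlineAlg.runLoad, load]

theorem runLoad_concat {f : ℕ} (A : OnlineAlg f) (s : ℝ) (h : List Job) (j : Job)
    (i : Machine f) :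
    A.runLoad s (h ++ [j]) i = A.runLoad s h i + if A h j = i then procTime s j i else 0 :=
  load_run_append s A h j i

/-! ### The upper bound, and reduction of the ratio to nearly extremal sequences -/

section Upper

variable {f : ℕ} {s : ℝ} {A : OnlineAlg f}

/-- Under Greedy, the total load of any `f` machines is at most the total size of the jobs. -/
theorem IsGreedy.sum_runLoad_le (hA : IsGreedy s A) (h : List Job) :
    ∀ S : Finset (Machine f), S.card = f → ∑ i ∈ S, A.runLoad s h i ≤ volume 0 h + volume 1 h := by
  induction h using List.reverseRecOn with
  | nil => intro S _; simp [runLoad_nil, volume]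
  | append_singleton h j ih =>
    intro S hS
    have hj : volume 0 [j] + volume 1 [j] = j.size := by
      have : j.fav = 0 ∨ j.fav = 1 := by omega
      rcases this with e | e <;> simp [volume_singleton, e]
    simp only [runLoad_concat, Finset.sum_add_distrib, Finset.sum_ite_eq, volume_append]
    have key : ∑ i ∈ S, A.runLoad s h i + (if A h j ∈ S then procTime s j (A h j) else 0) ≤
        volume 0 h + volume 1 h + j.size := by
      split_ifs with hm
      · by_cases hfav : (A h j).1 = j.fav
        · simpa [procTime, hfav] using ih S hS
        -- The set `S` has `f` elements, one of them outside the favorite group, so it misses a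
        -- favorite machine `k`. Greedy preferred `A h j` to `k`, so exchanging the two in `S`
        -- reduces the claim to the induction hypothesis.
        obtain ⟨k, hk, hkS⟩ : ∃ k : Machine f, k.1 = j.fav ∧ k ∉ S := by
          by_contra! hcon
          have hsub : insert (A h j) (({j.fav} : Finset (Fin 2)) ×ˢ Finset.univ) ⊆ S := by
            intro k hk
            rcases Finset.mem_insert.1 hk with rfl | hk
            · exact hm
            · exact hcon k (Finset.mem_singleton.1 (Finset.mem_product.1 hk).1)
          have := Finset.card_le_card hsub
          rw [Finset.card_insert_of_notMem (fun hk =>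
            hfav (Finset.mem_singleton.1 (Finset.mem_product.1 hk).1)), Finset.card_product] at this
          simp at this
          omega
        have h1 := ih (insert k (S.erase (A h j))) (by
          rw [Finset.card_insert_of_notMem (fun hk' => hkS (Finset.mem_of_mem_erase hk')),
            Finset.card_erase_of_mem hm]
          have := Finset.card_pos.2 ⟨_, hm⟩
          omega)
        rw [Finset.sum_insert (fun hk' => hkS (Finset.mem_of_mem_erase hk'))] at h1
        have h2 := Finset.add_sum_erase S (A.runLoad s h) hm
        have h3 : A.runLoad s h (A h j) + procTime s j (A h j) ≤
          A.runLoad s h k + procTime s j k := hA h j k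
        have h4 : procTime s j k = j.size := by simp [procTime, hk]
        linarith
      · have := ih S hS
        linarith [j.size_pos]
    linarith

/-- Each term of the minimum is a weighted average of Greedy's alternatives, with loads bounded by
volumes and volumes by `T`. The size `p` of the new job ends up with a nonnegative coefficient, so
`p ≤ T` finishes the estimate. -/
theorem IsGreedy.completion_le (hf : 1 ≤ f) (hs : 1 ≤ s) (hA : IsGreedy s A) (h : List Job)
    (j : Job) {T : ℝ} (hT : IsVolumeBound f s (h ++ [j]) T) :
    A.runLoad s h (A h j) + procTime s j (A h j) ≤ greedyBound f s * T := by
  have hf0 : (1 : ℝ) ≤ f := by exact_mod_cast hf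
  set C := A.runLoad s h (A h j) + procTime s j (A h j) with hC
  have hgreedy : ∀ i, C ≤ A.runLoad s h i + procTime s j i := hA h j
  obtain ⟨d, hd⟩ : ∃ d : Fin 2, j.fav ≠ d := ⟨1 - j.fav, by omega⟩
  set c := j.fav with hc
  set p := j.size with hp
  have hp0 : 0 < p := j.size_pos
  have hpT : p ≤ T := hT.size_le j (by simp)
  have hcc : volume c (h ++ [j]) = volume c h + p := by
    rw [volume_append, volume_singleton, if_pos hc.symm]
  have hdd : volume d (h ++ [j]) = volume d h := by
    rw [volume_append, volume_singleton, if_neg (hc ▸ hd), add_zero]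
  have v1 := hT.mul_volume_add_le c d hd
  have v2 := hT.mul_volume_add_le d c hd.symm
  rw [hcc, hdd] at v1 v2
  set G : Fin 2 → ℝ := fun g => ∑ k : Fin f, A.runLoad s h (g, k) with hG
  have hCc : f * C ≤ G c + f * p := by
    have := Finset.sum_le_sum fun (k : Fin f) (_ : k ∈ Finset.univ) => hgreedy (c, k)
    simpa [Finset.sum_add_distrib, procTime, ← hc, ← hp] using this
  have hCd : f * C ≤ G d + f * (s * p) := by
    have := Finset.sum_le_sum fun (k : Fin f) (_ : k ∈ Finset.univ) => hgreedy (d, k)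
    simpa [Finset.sum_add_distrib, procTime, ← hc, ← hp, hd.symm] using this
  have hsum : ∀ x : Fin 2 → ℝ, ∑ e, x e = x c + x d := fun x => by
    have : (c = 0 ∧ d = 1) ∨ (c = 1 ∧ d = 0) := by omega
    rcases this with ⟨e1, e2⟩ | ⟨e1, e2⟩ <;> rw [e1, e2, Fin.sum_univ_two]
    ring
  have hw : ∀ x y z t : ℝ, x ≤ z → x * s ≤ t → y * s ≤ z → y ≤ t →
      x * G c + y * G d ≤ z * volume c h + t * volume d h := by
    intro x y z t h1 h2 h3 h4
    have := sum_mul_load_le (s := s) h (A.run h) (v := fun e => if e = c then z else t)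
      (w := fun e => if e = c then x else y) fun e g => by
        have e1 : e = c ∨ e = d := by omega
        have e2 : g = c ∨ g = d := by omega
        unfold slowdown
        rcases e1 with e1 | e1 <;> rcases e2 with e2 | e2 <;> simp [e1, e2, hd, hd.symm] <;> assumption
    rw [hsum, Fintype.sum_prod_type, hsum] at this
    simpa [hd.symm, hG, Finset.mul_sum, OnlineAlg.runLoad] using this
  have hden : (0 : ℝ) < f * (s + 1) := by positivity
  have b1 : C ≤ (1 + (2 - 1 / (f : ℝ)) * (s ^ 2 / (s + 1))) * T := by
    -- The right side is `s` times the weighted volume of `v1`; the reversed weights below lead to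
    -- `v2` in the same way.
    have h1 := hw 1 s (s ^ 2) s (by nlinarith) (by linarith) (by nlinarith) le_rfl
    have h2 : f * (s + 1) * C ≤ (s * (f * (s + 1)) + f * (1 + s ^ 2) - s ^ 2) * T := by
      have h3 : 0 ≤ f * (1 + s ^ 2) - s ^ 2 := by nlinarith [sq_nonneg s]
      have := mul_le_mul_of_nonneg_left hpT h3
      nlinarith
    have h4 : (1 + (2 - 1 / (f : ℝ)) * (s ^ 2 / (s + 1))) * T =
        (s * (f * (s + 1)) + f * (1 + s ^ 2) - s ^ 2) * T / (f * (s + 1)) := by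
      field_simp
      ring
    rw [h4, le_div_iff₀ hden]
    linarith
  have b2 : C ≤ (s + (2 - 1 / (f : ℝ)) * (s / (s + 1))) * T := by
    have h1 := hw s 1 s (s ^ 2) le_rfl (by nlinarith) (by linarith) (by nlinarith)
    have h2 : f * (s + 1) * C ≤ (s * (f * (s + 1)) + 2 * f * s - s) * T := by
      have h3 : 0 ≤ 2 * f * s - s := by nlinarith
      have := mul_le_mul_of_nonneg_left hpT h3
      nlinarith
    have h4 : (s + (2 - 1 / (f : ℝ)) * (s / (s + 1))) * T =
        (s * (f * (s + 1)) + 2 * f * s - s) * T / (f * (s + 1)) := by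
      field_simp
      ring
    rw [h4, le_div_iff₀ hden]
    linarith
  have b3 : C ≤ (3 - 1 / (f : ℝ)) * T := by
    have h1 := hA.sum_runLoad_le h (({c} : Finset (Fin 2)) ×ˢ Finset.univ) (by simp)
    rw [Finset.sum_product, Finset.sum_singleton] at h1
    have h2 : volume 0 (h ++ [j]) + volume 1 (h ++ [j]) = volume 0 h + volume 1 h + p := by
      have e1 := hsum fun e => volume e (h ++ [j])
      have e2 := hsum fun e => volume e h
      simp only [Fin.sum_univ_two] at e1 e2
      linarith
    have h3 := hT.volume_add_le
    have h4 : (3 - 1 / (f : ℝ)) * T = (3 * f - 1) * T / f := by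
      field_simp
    rw [h4, le_div_iff₀ (by linarith)]
    have h5 : G c ≤ volume 0 h + volume 1 h := h1
    nlinarith
  have hT0 : 0 ≤ T := hp0.le.trans hpT
  unfold greedyBound
  rcases min_choice (min (1 + (2 - 1 / (f : ℝ)) * (s ^ 2 / (s + 1)))
    (s + (2 - 1 / (f : ℝ)) * (s / (s + 1)))) (3 - 1 / (f : ℝ)) with e | e <;> rw [e]
  · rcases min_choice (1 + (2 - 1 / (f : ℝ)) * (s ^ 2 / (s + 1)))
      (s + (2 - 1 / (f : ℝ)) * (s / (s + 1))) with e | e <;> rw [e] <;> assumption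
  · exact b3

theorem greedyBound_nonneg (hf : 1 ≤ f) (hs : 1 ≤ s) : 0 ≤ greedyBound f s := by
  have hf0 : (1 : ℝ) ≤ f := by exact_mod_cast hf
  have h1 : 1 / (f : ℝ) ≤ 1 := by rw [div_le_one] <;> linarith
  have h2 : 0 ≤ 2 - 1 / (f : ℝ) := by linarith
  unfold greedyBound
  refine le_min (le_min ?_ ?_) (by linarith) <;> positivity

theorem IsGreedy.runLoad_le (hf : 1 ≤ f) (hs : 1 ≤ s) (hA : IsGreedy s A) (h : List Job) {T : ℝ}
    (hT0 : 0 ≤ T) (hT : IsVolumeBound f s h T) (i : Machine f) :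
    A.runLoad s h i ≤ greedyBound f s * T := by
  induction h using List.reverseRecOn with
  | nil => rw [runLoad_nil]; exact mul_nonneg (greedyBound_nonneg hf hs) hT0
  | append_singleton h j ih =>
    rw [runLoad_concat]
    split_ifs with e
    · rw [← e]
      exact hA.completion_le hf hs h j hT
    · rw [add_zero]
      exact ih (hT.of_append hs)

theorem exists_makespan_eq_optCost (hf : 1 ≤ f) (s : ℝ) (I : List Job) :
    ∃ σ : Fin I.length → Machine f, makespan s I σ = optCost f s I := by
  have : NeZero f := ⟨by omega⟩
  exact exists_eq_ciInf_of_finite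

theorem optCost_pos (hf : 1 ≤ f) (hs : 1 ≤ s) {I : List Job} (hI : I ≠ []) :
    0 < optCost f s I := by
  obtain ⟨σ, hσ⟩ := exists_makespan_eq_optCost hf s I
  rw [← hσ]
  exact (isVolumeBound_makespan hs I σ).pos hI

theorem IsGreedy.cost_le (hf : 1 ≤ f) (hs : 1 ≤ s) (hA : IsGreedy s A) {I : List Job}
    (hI : I ≠ []) : A.cost s I ≤ greedyBound f s * optCost f s I := by
  obtain ⟨σ, hσ⟩ := exists_makespan_eq_optCost hf s I
  have hb := isVolumeBound_makespan hs I σ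
  rw [hσ] at hb
  have : NeZero f := ⟨by omega⟩
  exact ciSup_le fun i => hA.runLoad_le hf hs I (optCost_pos hf hs hI).le hb i

/-- Nearly extremal job sequences determine the competitive ratio. -/
theorem IsGreedy.hasCompetitiveRatio (hf : 1 ≤ f) (hs : 1 ≤ s) (hA : IsGreedy s A)
    (H : ∀ η > 0, ∃ I : List Job, I ≠ [] ∧ optCost f s I ≤ 1 + η ∧
      greedyBound f s - η ≤ A.cost s I) :
    HasCompetitiveRatio s A (greedyBound f s) := by
  refine ⟨?_, fun b hb => ?_⟩
  · rintro r ⟨I, hI, rfl⟩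
    rw [div_le_iff₀ (optCost_pos hf hs hI)]
    exact hA.cost_le hf hs hI
  · by_contra! hlt
    have hb' : ∀ I : List Job, I ≠ [] → A.cost s I ≤ b * optCost f s I := fun I hI => by
      rw [← div_le_iff₀ (optCost_pos hf hs hI)]
      exact hb ⟨I, hI, rfl⟩
    have hb0 : 0 ≤ b := by
      obtain ⟨I, hI, -⟩ := H 1 one_pos
      have h1 := hb' I hI
      have h2 := optCost_pos hf hs hI
      have h3 : 0 ≤ A.cost s I :=
        (load_nonneg hs I _ (0, ⟨0, hf⟩)).trans (load_le_makespan s I _ (0, ⟨0, hf⟩))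
      by_contra! h4
      nlinarith
    -- A bound `b` would give `greedyBound f s - b ≤ η * (1 + b)`, which is only half of the left
    -- side.
    set η := (greedyBound f s - b) / (2 * (1 + b)) with hη
    have hη0 : 0 < η := div_pos (by linarith) (by positivity)
    have hη1 : η * (2 * (1 + b)) = greedyBound f s - b := div_mul_cancel₀ _ (by positivity)
    obtain ⟨I, hI, h1, h2⟩ := H η hη0
    have h3 := hb' I hI
    nlinarith [mul_le_mul_of_nonneg_left h1 hb0]

end Upper

/-! ### Phases in which Greedy raises a whole group evenly -/

section Phases

variable {f : ℕ} {s : ℝ} {A : OnlineAlg f}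

/-- If the machines of `S` have the same load, and a job of the same kind has to be put on `S`
until all of them have received one, then `S.card` such jobs raise the load on `S` evenly. -/
theorem IsGreedy.runLoad_append_replicate (hA : IsGreedy s A) (h : List Job) (j : Job)
    (S : Finset (Machine f)) {v P : ℝ} (hP : 0 < P) (hv : ∀ i ∈ S, A.runLoad s h i = v)
    (hSP : ∀ i ∈ S, procTime s j i = P)
    (hS : ∀ i ∉ S, v + P < A.runLoad s h i + procTime s j i) (i : Machine f) :
    A.runLoad s (h ++ List.replicate S.card j) i =
      A.runLoad s h i + if i ∈ S then P else 0 := by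
  have key : ∀ n ≤ S.card, ∃ U ⊆ S, U.card = n ∧ ∀ i,
      A.runLoad s (h ++ List.replicate n j) i = A.runLoad s h i + if i ∈ U then P else 0 := by
    intro n
    induction n with
    | zero => exact fun _ => ⟨∅, by simp, by simp, by simp⟩
    | succ n ih =>
      intro hn
      obtain ⟨U, hUS, hU, hload⟩ := ih (by omega)
      set h' := h ++ List.replicate n j with hh'
      have e : h ++ List.replicate (n + 1) j = h' ++ [j] := by
        rw [hh', List.replicate_succ', List.append_assoc]
      -- A machine of `S` not used yet offers `v + P`. This is strictly better than any machine
      -- outside `S`, and than a used machine of `S`, which offers `v + P + P`.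
      obtain ⟨k, hkS, hkU⟩ : ∃ k ∈ S, k ∉ U := by
        by_contra! hcon
        have := Finset.card_le_card (show S ⊆ U from hcon)
        omega
      have hk : A.runLoad s h' (A h' j) + procTime s j (A h' j) ≤ v + P := by
        have := hA h' j k
        change A.runLoad s h' _ + _ ≤ A.runLoad s h' k + _ at this
        rw [hload k, if_neg hkU, hv k hkS, hSP k hkS, add_zero] at this
        exact this
      have hmS : A h' j ∈ S := by
        by_contra hm
        have h1 := hS _ hm
        rw [hload, if_neg (fun hm' => hm (hUS hm'))] at hk
        linarith
      have hmU : A h' j ∉ U := by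
        intro hm
        rw [hload, if_pos hm, hv _ hmS, hSP _ hmS] at hk
        linarith
      refine ⟨insert (A h' j) U, Finset.insert_subset hmS hUS, by
        rw [Finset.card_insert_of_notMem hmU, hU], fun i => ?_⟩
      rw [e, runLoad_concat, hload, add_assoc]
      congr 1
      by_cases hi : A h' j = i
      · subst hi
        simp [hmU, hSP _ hmS]
      · simp [hi, Ne.symm hi]
  obtain ⟨U, hUS, hU, hload⟩ := key S.card le_rfl
  rw [hload, Finset.eq_of_subset_of_card_le hUS hU.ge]

/-- After the jobs of `h`, the machines of the two groups have the loads `x` and `y`. -/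
def HasLevels (A : OnlineAlg f) (s : ℝ) (h : List Job) (x y : ℝ) : Prop :=
  ∀ i, A.runLoad s h i = if i.1 = 0 then x else y

theorem hasLevels_nil : HasLevels A s [] 0 0 := fun i => by simp [runLoad_nil]

theorem HasLevels.raise_fst (hs : 1 ≤ s) (hA : IsGreedy s A) {h : List Job} {x y : ℝ}
    (hl : HasLevels A s h x y) (j : Job)
    (hlt : x + slowdown s j.fav 0 * j.size < y + slowdown s j.fav 1 * j.size) :
    HasLevels A s (h ++ List.replicate f j) (x + slowdown s j.fav 0 * j.size) y := by
  have hP : 0 < slowdown s j.fav 0 * j.size :=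
    mul_pos (one_pos.trans_le (one_le_slowdown hs _ _)) j.size_pos
  intro i
  have key := hA.runLoad_append_replicate h j (({0} : Finset (Fin 2)) ×ˢ Finset.univ)
    (v := x) hP (fun i hi => by
      rw [hl i, if_pos (Finset.mem_singleton.1 (Finset.mem_product.1 hi).1)])
    (fun i hi => by
      rw [procTime_eq, Finset.mem_singleton.1 (Finset.mem_product.1 hi).1])
    (fun i hi => by
      have h0 : i.1 ≠ 0 := fun h0 => hi (Finset.mem_product.2
        ⟨Finset.mem_singleton.2 h0, Finset.mem_univ _⟩)
      have h1 : i.1 = 1 := by omega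
      rw [hl i, procTime_eq, if_neg h0, h1]
      exact hlt) i
  simp only [Finset.card_product, Finset.card_singleton, one_mul, Finset.card_univ,
    Fintype.card_fin, Finset.mem_product, Finset.mem_singleton, Finset.mem_univ, and_true] at key
  rw [key, hl i]
  split_ifs <;> simp

theorem HasLevels.raise_snd (hs : 1 ≤ s) (hA : IsGreedy s A) {h : List Job} {x y : ℝ}
    (hl : HasLevels A s h x y) (j : Job)
    (hlt : y + slowdown s j.fav 1 * j.size < x + slowdown s j.fav 0 * j.size) :
    HasLevels A s (h ++ List.replicate f j) x (y + slowdown s j.fav 1 * j.size) := by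
  have hP : 0 < slowdown s j.fav 1 * j.size :=
    mul_pos (one_pos.trans_le (one_le_slowdown hs _ _)) j.size_pos
  intro i
  have key := hA.runLoad_append_replicate h j (({1} : Finset (Fin 2)) ×ˢ Finset.univ)
    (v := y) hP (fun i hi => by
      rw [hl i, if_neg]
      rw [Finset.mem_singleton.1 (Finset.mem_product.1 hi).1]
      exact one_ne_zero)
    (fun i hi => by
      rw [procTime_eq, Finset.mem_singleton.1 (Finset.mem_product.1 hi).1])
    (fun i hi => by
      have h1 : i.1 ≠ 1 := fun h1 => hi (Finset.mem_product.2
        ⟨Finset.mem_singleton.2 h1, Finset.mem_univ _⟩)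
      have h0 : i.1 = 0 := by omega
      rw [hl i, procTime_eq, if_pos h0, h0]
      exact hlt) i
  simp only [Finset.card_product, Finset.card_singleton, one_mul, Finset.card_univ,
    Fintype.card_fin, Finset.mem_product, Finset.mem_singleton, Finset.mem_univ, and_true] at key
  rw [key, hl i]
  have : i.1 = 0 ∨ i.1 = 1 := by omega
  rcases this with e | e <;> simp [e]

theorem le_cost_append_singleton (h : List Job) (j : Job) {b : ℝ}
    (hb : ∀ i, b ≤ A.runLoad s h i + procTime s j i) : b ≤ A.cost s (h ++ [j]) := by
  have h1 := runLoad_concat A s h j (A h j)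
  rw [if_pos rfl] at h1
  have h2 : A.runLoad s (h ++ [j]) (A h j) ≤ A.cost s (h ++ [j]) :=
    load_le_makespan s (h ++ [j]) _ _
  linarith [hb (A h j)]

theorem HasLevels.le_cost {h : List Job} {x y b : ℝ} (hl : HasLevels A s h x y)
    (j : Job) (h0 : b ≤ x + slowdown s j.fav 0 * j.size)
    (h1 : b ≤ y + slowdown s j.fav 1 * j.size) : b ≤ A.cost s (h ++ [j]) := by
  refine le_cost_append_singleton h j fun i => ?_
  rw [hl i, procTime_eq]
  have : i.1 = 0 ∨ i.1 = 1 := by omega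
  rcases this with e | e <;> simpa [e]

end Phases

/-! ### Building allocations for the optimum -/

section Fits

variable {f : ℕ} {s : ℝ}

/-- The jobs of `I` can be allocated so that the load of each machine `i` is at most `L i`. -/
def Fits (s : ℝ) (I : List Job) (L : Machine f → ℝ) : Prop :=
  ∃ σ : Fin I.length → Machine f, ∀ i, load s I σ i ≤ L i

theorem Fits.mono {I : List Job} {L L' : Machine f → ℝ} (h : Fits s I L) (hL : ∀ i, L i ≤ L' i) :
    Fits s I L' := by
  obtain ⟨σ, hσ⟩ := h
  exact ⟨σ, fun i => (hσ i).trans (hL i)⟩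

theorem fits_nil {L : Machine f → ℝ} (hL : ∀ i, 0 ≤ L i) : Fits s [] L :=
  ⟨fun k => k.elim0, fun i => by simpa [load] using hL i⟩

theorem Fits.append {I J : List Job} {L M : Machine f → ℝ} (hI : Fits s I L) (hJ : Fits s J M) :
    Fits s (I ++ J) (fun i => L i + M i) := by
  obtain ⟨σ, hσ⟩ := hI
  obtain ⟨τ, hτ⟩ := hJ
  have e : (I ++ J).length = I.length + J.length := List.length_append
  refine ⟨fun k => Fin.append σ τ (k.cast e), fun i => ?_⟩
  refine le_trans (le_of_eq ?_) (add_le_add (hσ i) (hτ i))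
  unfold load
  rw [← (finCongr e.symm).sum_comp, Fin.sum_univ_add]
  simp

theorem fits_singleton (j : Job) (m : Machine f) :
    Fits s [j] (fun i => if i = m then procTime s j m else 0) := by
  refine ⟨fun _ => m, fun i => ?_⟩
  by_cases h : m = i
  · subst h; simp [load]
  · simp [load, h, Ne.symm h]

/-- Equal jobs, each of which is put on a prescribed machine. -/
theorem fits_replicate (j : Job) (n : ℕ) (m : ℕ → Machine f) :
    Fits s (List.replicate n j)
      (fun i => ∑ k ∈ Finset.range n, if i = m k then procTime s j i else 0) := by
  induction n with
  | zero => exact fits_nil fun i => by simp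
  | succ n ih =>
    rw [List.replicate_succ']
    refine (ih.append (fits_singleton j (m n))).mono fun i => ?_
    rw [Finset.sum_range_succ]
    refine add_le_add le_rfl ?_
    split_ifs with h
    · rw [h]
    · exact le_rfl

/-- Equal jobs, one on each machine of a group. -/
theorem fits_replicate_group (j : Job) (g : Fin 2) :
    Fits s (List.replicate f j)
      (fun i : Machine f => if i.1 = g then slowdown s j.fav g * j.size else 0) := by
  rcases Nat.eq_zero_or_pos f with rfl | hf
  · exact fits_nil fun i => i.2.elim0
  refine (fits_replicate j f fun k => (g, ⟨k % f, Nat.mod_lt _ hf⟩)).mono fun i => ?_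
  rw [Finset.sum_eq_single_of_mem (i.2 : ℕ) (by simp) fun k hk hne => ?_]
  · by_cases h : i.1 = g
    · simp only [procTime_eq, h]
      split_ifs
      · exact le_rfl
      · simp_all [Prod.ext_iff, Fin.ext_iff, Nat.mod_eq_of_lt i.2.2]
    · simp [Prod.ext_iff, h]
  · rw [if_neg]
    intro h
    have h2 := congrArg (fun m : Machine f => (m.2 : ℕ)) h
    simp only [Nat.mod_eq_of_lt (Finset.mem_range.1 hk)] at h2
    exact hne h2.symm

/-- Equal jobs of the first group, one on each machine of this group, but the one of machine
`(0, 0)` is moved to the machine `(0, t)`. -/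
theorem fits_replicate_move [NeZero f] {u : ℝ} (hu : 0 < u) (t : Fin f) :
    Fits s (List.replicate f ⟨u, hu, 0⟩) (fun i : Machine f => if i.1 = 0 then
      (if i.2 = 0 then 0 else u) + (if i.2 = t then u else 0) else 0) := by
  have hf : 0 < f := Nat.pos_of_ne_zero (NeZero.ne f)
  refine (fits_replicate (⟨u, hu, 0⟩ : Job) f fun k => if k = 0 then (0, t) else
    (0, ⟨k % f, Nat.mod_lt _ hf⟩)).mono fun i => ?_
  obtain ⟨n, rfl⟩ : ∃ n, f = n + 1 := ⟨f - 1, by omega⟩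
  rw [Finset.sum_range_succ']
  by_cases h : i.1 = 0
  · simp only [procTime_eq, h, if_true]
    have hi : i = (0, i.2) := Prod.ext h rfl
    refine add_le_add ?_ (le_of_eq ?_)
    · rcases Fin.eq_zero_or_eq_succ i.2 with e | ⟨l, hl⟩
      · rw [if_pos e]
        refine le_of_eq (Finset.sum_eq_zero fun k hk => ?_)
        rw [if_neg]
        rw [if_neg (Nat.succ_ne_zero k), hi, e]
        intro h2
        have h3 := congrArg (fun m : Machine (n + 1) => (m.2 : ℕ)) h2
        simp [Nat.mod_eq_of_lt (Nat.succ_lt_succ (Finset.mem_range.1 hk))] at h3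
      · rw [hl, if_neg (Fin.succ_ne_zero l), Finset.sum_eq_single_of_mem (l : ℕ) (by simp)]
        · split_ifs <;> simp [slowdown, hu.le]
        · intro k hk hne
          rw [if_neg]
          rw [if_neg (Nat.succ_ne_zero k), hi, hl]
          intro h2
          have h3 := congrArg (fun m : Machine (n + 1) => (m.2 : ℕ)) h2
          simp only [Nat.mod_eq_of_lt (Nat.succ_lt_succ (Finset.mem_range.1 hk)),
            Fin.val_succ] at h3
          omega
    · rw [hi]
      simp [slowdown]
  · rw [if_neg h]
    refine add_nonpos (Finset.sum_nonpos fun k _ => ?_) ?_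
    · rw [if_neg]
      intro h2
      rw [h2] at h
      simp at h
    · rw [if_neg]
      intro h2
      rw [h2] at h
      simp at h

/-- Small jobs can be allocated almost as if they were fluid. -/
theorem fits_of_size_le (I : List Job) {ε : ℝ} (hε : ∀ j ∈ I, j.size ≤ ε)
    (cap : Fin 2 → Machine f → ℝ) (hcap0 : ∀ c i, 0 ≤ cap c i) (hε0 : 0 ≤ ε)
    (hcap : ∀ c, volume c I ≤ ∑ i, cap c i) (hs : 0 ≤ s) :
    Fits s I (fun i => ∑ c, slowdown s c i.1 * (cap c i + ε)) := by
  have hsl : ∀ c g, 0 ≤ slowdown s c g := fun c g => by unfold slowdown; split_ifs <;> linarith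
  obtain ⟨V, hV, -, hF⟩ : ∃ V : Fin 2 → Machine f → ℝ, (∀ c i, V c i ≤ cap c i + ε) ∧
      (∀ c, ∑ i, V c i = volume c I) ∧ Fits s I (fun i => ∑ c, slowdown s c i.1 * V c i) := by
    induction I using List.reverseRecOn with
    | nil =>
      refine ⟨fun _ _ => 0, fun c i => add_nonneg (hcap0 c i) hε0, by simp [volume],
        fits_nil fun i => by simp⟩
    | append_singleton I j ih =>
      have hj : j.size ≤ ε := hε j (by simp)
      obtain ⟨V, hV, hsum, hF⟩ := ih (fun k hk => hε k (by simp [hk])) fun c => by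
        have h1 := hcap c
        have h2 := volume_nonneg c [j]
        rw [volume_append] at h1
        linarith
      -- While volume remains, some machine is strictly below its capacity. Adding one job there
      -- overshoots by at most `ε`.
      obtain ⟨m, -, hm⟩ : ∃ m ∈ Finset.univ, V j.fav m < cap j.fav m := by
        refine Finset.exists_lt_of_sum_lt ?_
        have h1 := hcap j.fav
        rw [volume_append, volume_singleton, if_pos rfl] at h1
        rw [hsum]
        linarith [j.size_pos]
      refine ⟨fun c i => V c i + if c = j.fav ∧ i = m then j.size else 0, fun c i => ?_,
        fun c => ?_, (hF.append (fits_singleton j m)).mono fun i => ?_⟩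
      · dsimp only
        split_ifs with h
        · rw [h.1, h.2]; linarith
        · rw [add_zero]; exact hV c i
      · rw [Finset.sum_add_distrib, hsum, volume_append, volume_singleton]
        by_cases h : c = j.fav
        · simp [h]
        · simp [h, Ne.symm h]
      · simp only [mul_add, Finset.sum_add_distrib]
        refine add_le_add le_rfl (le_of_eq ?_)
        by_cases h : i = m
        · simp [h, procTime_eq]
        · simp [h]
  exact hF.mono fun i => Finset.sum_le_sum fun c _ =>
    mul_le_mul_of_nonneg_left (hV c i) (hsl c _)

theorem Fits.optCost_le (hf : 1 ≤ f) {I : List Job} {B : ℝ}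
    (h : Fits s I (fun _ : Machine f => B)) : optCost f s I ≤ B := by
  obtain ⟨σ, hσ⟩ := h
  have : NeZero f := ⟨by omega⟩
  exact (ciInf_le (Set.finite_range _).bddBelow σ).trans (ciSup_le hσ)

end Fits

/-! ### Explicit sequences for identical machines, one machine per group, and large `s` -/

section Sequences

variable {f : ℕ} {s : ℝ} {A : OnlineAlg f}

/-- Cyclic distribution of `n * d` equal jobs over the machines `1, …, d`; the shift by one leaves
machine `0` for the large job. -/
theorem card_filter_eq_mod_add_one_le (n d : ℕ) {x : ℕ} (hx : 0 < x) :
    (Finset.filter (fun k => x = k % d + 1) (Finset.range (n * d))).card ≤ n := by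
  have h1 : Finset.filter (fun k => x = k % d + 1) (Finset.range (n * d)) ⊆
      (Finset.range n).image (fun l => d * l + (x - 1)) := by
    intro k hk
    obtain ⟨hk1, hk2⟩ := Finset.mem_filter.1 hk
    refine Finset.mem_image.2 ⟨k / d, Finset.mem_range.2 ?_, ?_⟩
    · exact Nat.div_lt_of_lt_mul (by simpa [mul_comm] using hk1)
    · have := Nat.div_add_mod k d
      omega
  exact (Finset.card_le_card h1).trans (Finset.card_image_le.trans (by simp))

/-- Identical machines: equal jobs followed by a large job. -/
theorem IsGreedy.exists_jobs_of_eq_one (hf : 1 ≤ f) (hA : IsGreedy 1 A) :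
    ∃ I : List Job, I ≠ [] ∧ optCost f 1 I ≤ 1 ∧
      1 + (2 - 1 / (f : ℝ)) / 2 ≤ A.cost 1 I := by
  have hf0 : (1 : ℝ) ≤ f := by exact_mod_cast hf
  have hq : (0 : ℝ) < 1 / (2 * f) := by positivity
  have : NeZero f := ⟨by omega⟩
  set j : Job := ⟨1 / (2 * f), hq, 0⟩ with hj
  have hpt : ∀ (k : Job) (i : Machine f), procTime 1 k i = k.size := fun k i => by
    simp [procTime]
  have hload : ∀ n : ℕ, ∀ i, A.runLoad 1 (List.replicate (2 * f * n) j) i = n * (1 / (2 * f)) := by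
    intro n
    induction n with
    | zero => intro i; simp [runLoad_nil]
    | succ n ih =>
      intro i
      have h := hA.runLoad_append_replicate (List.replicate (2 * f * n) j) j Finset.univ hq
        (fun i _ => ih i) (fun i _ => by rw [hpt]) (fun i hi => absurd (Finset.mem_univ i) hi) i
      rw [Finset.card_univ, Fintype.card_prod, Fintype.card_fin, Fintype.card_fin,
        ← List.replicate_add, ih, if_pos (Finset.mem_univ i)] at h
      rw [mul_add, mul_one, h]
      push_cast
      ring
  -- Greedy spreads the small jobs to level `1 - 1 / (2 * f)` on all machines, whereas the optimum
  -- packs them at level `1` on all machines but one.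
  refine ⟨List.replicate (2 * f * (2 * f - 1)) j ++ [⟨1, one_pos, 0⟩], by simp,
    Fits.optCost_le hf ?_, le_cost_append_singleton _ _ fun i => ?_⟩
  · obtain ⟨e⟩ : Nonempty (Machine f ≃ Fin (2 * f)) := ⟨Fintype.equivFinOfCardEq (by simp)⟩
    obtain ⟨d, hd⟩ : ∃ d, 2 * f = d + 1 := ⟨2 * f - 1, by omega⟩
    have hd1 : 2 * f - 1 = d := by omega
    rw [hd1]
    have hmod : ∀ k, k % d + 1 < 2 * f := fun k => by
      have := Nat.mod_lt k (show d > 0 by omega)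
      omega
    refine (((fits_replicate j (2 * f * d) fun k => e.symm ⟨k % d + 1, hmod k⟩)).append
      (fits_singleton ⟨1, one_pos, 0⟩ (e.symm ⟨0, by omega⟩))).mono fun i => ?_
    simp only [hpt]
    obtain ⟨x, rfl⟩ := e.symm.surjective i
    simp only [e.symm.injective.eq_iff, Fin.ext_iff]
    rw [← Finset.sum_filter, Finset.sum_const, nsmul_eq_mul]
    rcases Nat.eq_zero_or_pos (x : ℕ) with h0 | h0
    · rw [Finset.filter_false_of_mem (fun k _ => by omega)]
      simp [h0]
    · have hcard := card_filter_eq_mod_add_one_le (2 * f) d h0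
      have h2 : ((Finset.filter (fun k => (x : ℕ) = k % d + 1)
          (Finset.range (2 * f * d))).card : ℝ) ≤ 2 * f := by exact_mod_cast hcard
      rw [if_neg (by omega), add_zero]
      calc _ ≤ 2 * (f : ℝ) * (1 / (2 * f)) := mul_le_mul_of_nonneg_right h2 hq.le
        _ = 1 := by field_simp
  · rw [hload, hpt, Nat.cast_sub (by omega)]
    push_cast
    refine le_of_eq ?_
    field_simp
    ring

/-- Two rounds of jobs of the second group, some jobs of the first group of size `1 / f`, and
a job of size `1`. -/
theorem IsGreedy.exists_jobs_of_two_sizes (hf : 1 ≤ f) (hs : 1 < s) (hA : IsGreedy s A)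
    {a q : ℝ} (ha : 0 < a) (hq : 0 < q) (haq : a + q ≤ 1) (hlt : s * q < a + q)
    (hsf : s * q + (1 - 1 / (f : ℝ)) < a + s / f ∨ f = 1) :
    ∃ I : List Job, I ≠ [] ∧ optCost f s I ≤ 1 ∧
      min (s * q + (2 - 1 / (f : ℝ))) (a + s) ≤ A.cost s I := by
  have hf0 : (1 : ℝ) ≤ f := by exact_mod_cast hf
  have hr : (0 : ℝ) < 1 / f := by positivity
  have : NeZero f := ⟨by omega⟩
  have h1 : HasLevels A s (List.replicate f ⟨a, ha, 1⟩) 0 a := by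
    have := (hasLevels_nil (A := A) (s := s)).raise_snd hs.le hA ⟨a, ha, 1⟩
      (by simp only [slowdown]; simp; nlinarith)
    simpa [slowdown] using this
  have h2 : HasLevels A s (List.replicate f ⟨a, ha, 1⟩ ++ List.replicate f ⟨q, hq, 1⟩)
      (s * q) a := by
    have := h1.raise_fst hs.le hA ⟨q, hq, 1⟩ (by simp only [slowdown]; simp; linarith)
    simpa [slowdown] using this
  set h := List.replicate f (⟨a, ha, 1⟩ : Job) ++ List.replicate f ⟨q, hq, 1⟩ with hh
  have h3 : ∀ n ≤ f - 1, HasLevels A s (h ++ List.replicate (n * f) ⟨1 / f, hr, 0⟩)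
      (s * q + n / f) a := by
    intro n
    induction n with
    | zero => intro _; simpa using h2
    | succ n ih =>
      intro hn
      have hn1 : ((n + 1 : ℕ) : ℝ) ≤ f - 1 := by
        rw [← Nat.cast_one (R := ℝ), ← Nat.cast_sub hf]
        exact_mod_cast hn
      have hn2 : ((n + 1 : ℕ) : ℝ) / f ≤ 1 - 1 / f := by
        rw [one_sub_div (by positivity)]
        exact div_le_div_of_nonneg_right hn1 (by positivity)
      have hsf' := hsf.resolve_right (by omega)
      push_cast at hn2
      rw [add_div] at hn2
      -- Condition `hsf` is the comparison for the last of the `f - 1` rounds, where the first group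
      -- is highest; it covers the earlier rounds too.
      have := (ih (by omega)).raise_fst hs.le hA ⟨1 / f, hr, 0⟩ (by
        simp only [slowdown, if_true, one_mul, one_ne_zero, if_false]
        rw [mul_one_div]
        linarith)
      rw [List.append_assoc, ← List.replicate_add, ← Nat.succ_mul] at this
      convert this using 1
      simp only [slowdown, if_true, one_mul]
      push_cast
      ring
  have hlast := h3 (f - 1) le_rfl
  refine ⟨h ++ List.replicate ((f - 1) * f) ⟨1 / f, hr, 0⟩ ++ [⟨1, one_pos, 0⟩], by simp,
    Fits.optCost_le hf ?_, ?_⟩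
  · obtain ⟨d, hd⟩ : ∃ d, f = d + 1 := ⟨f - 1, by omega⟩
    have hd1 : f - 1 = d := by omega
    rw [hd1]
    have hmod : ∀ k, k < d * f → k % d + 1 < f := fun k hk => by
      have : 0 < d := Nat.pos_of_ne_zero fun h0 => by simp [h0] at hk
      have := Nat.mod_lt k this
      omega
    have F1 := fits_replicate_group (f := f) (s := s) ⟨a, ha, 1⟩ 1
    have F2 := fits_replicate_group (f := f) (s := s) ⟨q, hq, 1⟩ 1
    have F3 := fits_replicate (f := f) (s := s) ⟨1 / f, hr, 0⟩ (d * f)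
      fun k => (0, Fin.ofNat f (k % d + 1))
    have F4 := fits_singleton (f := f) (s := s) ⟨1, one_pos, 0⟩ (0, 0)
    refine (((F1.append F2).append F3).append F4).mono fun i => ?_
    obtain ⟨g, x⟩ := i
    rw [← Finset.sum_filter, Finset.sum_const, nsmul_eq_mul]
    have hg : g = 0 ∨ g = 1 := by omega
    rcases hg with rfl | rfl
    · have hfil : ∀ k ∈ Finset.range (d * f), ((0 : Fin 2), x) = (0, Fin.ofNat f (k % d + 1)) ↔
          (x : ℕ) = k % d + 1 := fun k hk => by
        simp only [Prod.mk.injEq, true_and, Fin.ext_iff, Fin.ofNat,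
          Nat.mod_eq_of_lt (hmod k (Finset.mem_range.1 hk))]
      rw [Finset.filter_congr hfil]
      rcases Nat.eq_zero_or_pos (x : ℕ) with h0 | h0
      · rw [Finset.filter_false_of_mem (fun k _ => by omega)]
        have : x = 0 := Fin.ext (by simpa using h0)
        simp [this, procTime]
      · have hcard := card_filter_eq_mod_add_one_le f d h0
        rw [mul_comm] at hcard
        have h2 : ((Finset.filter (fun k => (x : ℕ) = k % d + 1)
            (Finset.range (d * f))).card : ℝ) ≤ f := by exact_mod_cast hcard
        have hx : x ≠ 0 := fun hx => by simp [hx] at h0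
        simp only [procTime, Prod.mk.injEq, hx]
        simp only [zero_ne_one, if_false, if_true, and_false, add_zero, zero_add]
        calc _ ≤ (f : ℝ) * (1 / f) := mul_le_mul_of_nonneg_right h2 hr.le
          _ = 1 := by field_simp
    · rw [Finset.filter_false_of_mem (fun k _ => by simp)]
      simpa [slowdown] using haq
  · apply hlast.le_cost
    · refine (min_le_left _ _).trans (le_of_eq ?_)
      rw [Nat.cast_sub hf]
      simp only [slowdown, if_true]
      push_cast
      field_simp
      ring
    · refine (min_le_right _ _).trans (le_of_eq ?_)
      simp [slowdown]

end Sequences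

/-! ### Climbing: geometric growth of the gap between the two groups -/

/-- The sizes of the jobs by which the gap between the levels of the two groups is raised from
`γ ^ (k + 1)` to `γ ^ k`. -/
noncomputable def climbSize (s γ : ℝ) (k : ℕ) : ℝ := γ ^ k * ((1 + γ) / s)

section Climb

variable {f : ℕ} {s γ : ℝ} {A : OnlineAlg f}

theorem climbSize_pos (hs : 1 < s) (hγ : s - 1 < γ) (k : ℕ) : 0 < climbSize s γ k := by
  have : 0 < γ := by linarith
  unfold climbSize
  positivity

/-- On the wrong group the job first closes the gap `γ ^ (k + 1)`, then opens the gap `γ ^ k` in the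
other direction. -/
theorem mul_climbSize (hs : 1 < s) (k : ℕ) :
    s * climbSize s γ k = γ ^ k + γ ^ (k + 1) := by
  unfold climbSize
  field_simp
  ring

/-- This is Greedy's preference for the wrong group: the right one would finish a full job size
above the level that the wrong one exceeds by only `γ ^ k`. -/
theorem pow_lt_climbSize (hs : 1 < s) (hγ : s - 1 < γ) (k : ℕ) : γ ^ k < climbSize s γ k := by
  have : 0 < γ ^ k := pow_pos (by linarith) k
  have h1 : 1 < (1 + γ) / s := by
    rw [one_lt_div (by linarith)]
    linarith
  exact lt_mul_of_one_lt_right this h1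

/-- Many small jobs, all of which Greedy puts on the wrong group. -/
theorem HasLevels.exists_small_jobs (hs : 1 < s) (hs2 : s < 2) (hA : IsGreedy s A) {δ : ℝ}
    (hδ : 0 < δ) (N : ℕ) {h : List Job} {x : ℝ} (hl : HasLevels A s h x (x + δ)) :
    ∃ J : List Job, HasLevels A s (h ++ J) (x + 2 * δ * N) (x + 2 * δ * N + δ) ∧
      (∀ c, volume c J = f * (2 * δ * N / s)) ∧ ∀ j ∈ J, j.size ≤ 2 * δ := by
  have hq : 0 < 2 * δ / s := by positivity
  have hqδ : δ < 2 * δ / s := by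
    rw [lt_div_iff₀ (by linarith)]
    nlinarith
  have hq2 : 2 * δ / s ≤ 2 * δ := div_le_self (by linarith) hs.le
  have hsq : s * (2 * δ / s) = 2 * δ := by field_simp
  induction N with
  | zero => exact ⟨[], by simpa using hl, by simp [volume], by simp⟩
  | succ N ih =>
    obtain ⟨J, hJ, hvol, hsize⟩ := ih
    -- A processing time `2 * δ` on the lower group reverses the gap `δ`. The right group would
    -- finish later because `δ < 2 * δ / s`, which is where `s < 2` enters.
    have h1 := hJ.raise_fst hs.le hA ⟨2 * δ / s, hq, 1⟩ (by
      simp only [slowdown, zero_ne_one, if_false, if_true, one_mul, hsq]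
      linarith)
    have h2 := h1.raise_snd hs.le hA ⟨2 * δ / s, hq, 0⟩ (by
      simp only [slowdown, one_ne_zero, zero_ne_one, if_false, if_true, one_mul, hsq]
      linarith)
    simp only [slowdown, one_ne_zero, zero_ne_one, if_false, hsq,
      List.append_assoc] at h2
    refine ⟨J ++ (List.replicate f ⟨2 * δ / s, hq, 1⟩ ++ List.replicate f ⟨2 * δ / s, hq, 0⟩),
      ?_, fun c => ?_, fun j hj => ?_⟩
    · convert h2 using 1 <;> push_cast <;> ring
    · rw [volume_append, volume_append, volume_replicate, volume_replicate, hvol]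
      have : c = 0 ∨ c = 1 := by omega
      rcases this with rfl | rfl <;> simp <;> field_simp
    · simp only [List.mem_append, List.mem_replicate] at hj
      rcases hj with hj | ⟨-, rfl⟩ | ⟨-, rfl⟩
      · exact hsize j hj
      · exact hq2
      · exact hq2

/-- A gap `γ ^ (2 * m + 2)` between the levels of the two groups is raised to `γ ^ 2`. -/
theorem HasLevels.exists_climb [NeZero f] (hs : 1 < s) (hγ : s - 1 < γ) (hA : IsGreedy s A)
    (t : ℕ → Fin f) (m : ℕ) {h : List Job} {x : ℝ}
    (hl : HasLevels A s h x (x + γ ^ (2 * m + 2))) :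
    ∃ J : List Job, HasLevels A s (h ++ J) (x + ∑ k ∈ Finset.range (2 * m), γ ^ (k + 3))
        (x + ∑ k ∈ Finset.range (2 * m), γ ^ (k + 3) + γ ^ 2) ∧
      Fits s J fun i : Machine f => if i.1 = 0 then
        (if i.2 = 0 then 0 else ∑ k ∈ Finset.range m, climbSize s γ (2 * k + 2)) +
          ∑ k ∈ Finset.range m, (if i.2 = t k then climbSize s γ (2 * k + 2) else 0)
        else ∑ k ∈ Finset.range m, climbSize s γ (2 * k + 3) := by
  induction m generalizing h x with
  | zero => exact ⟨[], by simpa using hl, fits_nil fun i => by simp⟩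
  | succ m ih =>
    have p1 := climbSize_pos hs hγ (2 * m + 3)
    have p2 := climbSize_pos hs hγ (2 * m + 2)
    have q1 := pow_lt_climbSize hs hγ (2 * m + 3)
    have q2 := pow_lt_climbSize hs hγ (2 * m + 2)
    have e1 := mul_climbSize (γ := γ) hs (2 * m + 3)
    have e2 := mul_climbSize (γ := γ) hs (2 * m + 2)
    have h1 := hl.raise_fst hs.le hA ⟨_, p1, 1⟩ (by
      simp only [slowdown, zero_ne_one, if_false, if_true, one_mul, e1]
      rw [show 2 * (m + 1) + 2 = 2 * m + 3 + 1 by ring]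
      linarith)
    simp only [slowdown, zero_ne_one, if_false, e1] at h1
    have h2 := h1.raise_snd hs.le hA ⟨_, p2, 0⟩ (by
      simp only [slowdown, one_ne_zero, if_false, if_true, one_mul, e2]
      rw [show 2 * (m + 1) + 2 = 2 * m + 3 + 1 by ring]
      linarith)
    simp only [slowdown, one_ne_zero, if_false, e2] at h2
    obtain ⟨J, hJ, hF⟩ := ih (x := x + (γ ^ (2 * m + 3) + γ ^ (2 * m + 3 + 1))) (by
      convert h2 using 1
      ring)
    rw [List.append_assoc, List.append_assoc] at hJ
    refine ⟨List.replicate f ⟨_, p1, 1⟩ ++ (List.replicate f ⟨_, p2, 0⟩ ++ J), ?_, ?_⟩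
    · convert hJ using 1
      · rw [show 2 * (m + 1) = 2 * m + 1 + 1 by ring, Finset.sum_range_succ,
          Finset.sum_range_succ]
        ring
      · rw [show 2 * (m + 1) = 2 * m + 1 + 1 by ring, Finset.sum_range_succ,
          Finset.sum_range_succ]
        ring
    · have F1 := fits_replicate_group (f := f) (s := s) ⟨_, p1, 1⟩ 1
      -- Moving one job to `(0, t m)` keeps machine `(0, 0)` free of climb jobs, for the final job
      -- of size `1`.
      have F2 := fits_replicate_move (f := f) (s := s) p2 (t m)
      refine (F1.append (F2.append hF)).mono fun i => ?_
      simp only [Finset.sum_range_succ]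
      have : i.1 = 0 ∨ i.1 = 1 := by omega
      rcases this with e | e
      · simp only [e, if_true, zero_ne_one, if_false]
        split_ifs <;> linarith
      · simp only [e, if_true, one_ne_zero, if_false, slowdown]
        linarith

/-- Job sequences on which Greedy puts every job but the last one on the wrong group, except
for a negligible part and the jobs that produce a gap `γ ^ (2 * m + 2)`. -/
theorem IsGreedy.exists_jobs_of_cap [NeZero f] (hs : 1 < s) (hs2 : s < 2) (hA : IsGreedy s A)
    (hγ : s - 1 < γ) (m : ℕ) {x : ℝ} (hx : 0 < x) (t : ℕ → Fin f)
    (cap : Fin 2 → Machine f → ℝ) {B κ : ℝ} (hκ : 0 < κ) (hcap0 : ∀ c i, 0 ≤ cap c i)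
    (hcap : ∀ c, f * (x / s) + κ ≤ ∑ i, cap c i)
    (hB0 : ∀ k : Fin f, (if k = 0 then 1 else ∑ l ∈ Finset.range m, climbSize s γ (2 * l + 2)) +
      ∑ l ∈ Finset.range m, (if k = t l then climbSize s γ (2 * l + 2) else 0) +
      cap 0 (0, k) + s * cap 1 (0, k) + κ ≤ B)
    (hB1 : ∀ k : Fin f, ∑ l ∈ Finset.range m, climbSize s γ (2 * l + 3) + climbSize s γ 1 +
      γ ^ (2 * m + 2) + s * cap 0 (1, k) + cap 1 (1, k) + κ ≤ B) :
    ∃ I : List Job, I ≠ [] ∧ optCost f s I ≤ B ∧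
      x + ∑ k ∈ Finset.range (2 * m + 2), γ ^ (k + 1) + 1 - (γ - (s - 1)) ≤ A.cost s I := by
  have hγ0 : 0 < γ := by linarith
  have hf : 1 ≤ f := Nat.one_le_iff_ne_zero.2 (NeZero.ne f)
  have hf0 : (1 : ℝ) ≤ f := by exact_mod_cast hf
  set g := γ ^ (2 * m + 2) with hg
  have hg0 : 0 < g := pow_pos hγ0 _
  -- The conditions on `δ` ensure, in this order, that the small jobs reach level `x` exactly, that
  -- the gap can be widened from `δ` to `g` on the favorite group, that `κ` covers the volume of the
  -- jobs creating the gap `δ`, and that `κ` covers the rounding error `2 * δ` of both kinds of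
  -- small jobs on a machine.
  obtain ⟨δ, N, hδ, hδN, hδg, hδκ, hδB⟩ : ∃ (δ : ℝ) (N : ℕ), 0 < δ ∧ 2 * δ * N = x ∧
      s * δ < (s - 1) * g ∧ f * δ ≤ κ ∧ (1 + s) * (2 * δ) ≤ κ := by
    set δ₀ := min ((s - 1) * g / s) (min (κ / f) (κ / (2 * (1 + s)))) with hδ₀
    have h0 : 0 < δ₀ := lt_min (div_pos (mul_pos (by linarith) hg0) (by linarith))
      (lt_min (by positivity) (by positivity))
    obtain ⟨N, hN⟩ := exists_nat_gt (x / (2 * δ₀))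
    have hN0 : (0 : ℝ) < N := lt_of_le_of_lt (by positivity) hN
    have hlt : x / (2 * N) < δ₀ := by
      rw [div_lt_iff₀ (by positivity)] at hN ⊢
      linarith
    refine ⟨x / (2 * N), N, by positivity, by field_simp, ?_, ?_, ?_⟩
    · have := hlt.trans_le (min_le_left _ _)
      rw [lt_div_iff₀ (by linarith)] at this
      linarith
    · have := (hlt.trans_le ((min_le_right _ _).trans (min_le_left _ _))).le
      rw [le_div_iff₀ (by linarith)] at this
      linarith
    · have := (hlt.trans_le ((min_le_right _ _).trans (min_le_right _ _))).le
      rw [le_div_iff₀ (by linarith)] at this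
      linarith
  have hδg' : 0 < g - δ := by nlinarith
  have l1 := (hasLevels_nil (A := A) (s := s)).raise_snd hs.le hA ⟨δ, hδ, 1⟩ (by
    simp only [slowdown, zero_ne_one, if_false, if_true]
    nlinarith)
  simp only [slowdown, if_true, one_mul, List.nil_append] at l1
  obtain ⟨J, hJ, hvol, hsize⟩ := l1.exists_small_jobs hs hs2 hA hδ N
  rw [zero_add, hδN] at hJ
  have l2 := hJ.raise_snd hs.le hA ⟨g - δ, hδg', 1⟩ (by
    simp only [slowdown, zero_ne_one, if_false, if_true]
    linarith)
  simp only [slowdown, if_true, one_mul] at l2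
  rw [show x + δ + (g - δ) = x + g by ring] at l2
  obtain ⟨J', hJ', hF⟩ := l2.exists_climb hs hγ hA t m
  have p1 := climbSize_pos hs hγ 1
  have l3 := hJ'.raise_fst hs.le hA ⟨_, p1, 1⟩ (by
    have := pow_lt_climbSize hs hγ 1
    simp only [slowdown, zero_ne_one, if_false, if_true, mul_climbSize hs, pow_one,
      one_add_one_eq_two] at this ⊢
    linarith)
  simp only [slowdown, zero_ne_one, if_false, mul_climbSize hs, pow_one, one_add_one_eq_two] at l3
  refine ⟨List.replicate f ⟨δ, hδ, 1⟩ ++ J ++ List.replicate f ⟨g - δ, hδg', 1⟩ ++ J' ++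
    List.replicate f ⟨_, p1, 1⟩ ++ [⟨1, one_pos, 0⟩], by simp, ?_, ?_⟩
  rotate_left
  -- The last job would finish on the second group `γ - (s - 1)` earlier than on the first; this is
  -- the loss in the claimed cost.
  · apply l3.le_cost
    · rw [Finset.sum_range_succ', Finset.sum_range_succ']
      simp only [slowdown, if_true]
      norm_num
      linarith
    · rw [Finset.sum_range_succ', Finset.sum_range_succ']
      simp only [slowdown, one_ne_zero, if_false]
      norm_num
      linarith
  -- Here `cap c i` is the room on machine `i` for small jobs with favorite group `c`, measured in
  -- job size, hence the factor `s` on the wrong group in `hB0` and `hB1`.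
  · have F1 := fits_of_size_le (s := s) (List.replicate f ⟨δ, hδ, 1⟩ ++ J) (ε := 2 * δ)
      (fun j hj => by
        simp only [List.mem_append, List.mem_replicate] at hj
        rcases hj with ⟨-, rfl⟩ | hj
        · simp only; linarith
        · exact hsize j hj) cap hcap0 (by linarith)
      (fun c => by
        refine le_trans ?_ (hcap c)
        rw [volume_append, volume_replicate, hvol, hδN]
        have : (f : ℝ) * (if (1 : Fin 2) = c then δ else 0) ≤ f * δ :=
          mul_le_mul_of_nonneg_left (by split_ifs <;> linarith) (by linarith)
        linarith) (by linarith)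
    have F2 := fits_replicate_group (f := f) (s := s) ⟨g - δ, hδg', 1⟩ 1
    have F3 := fits_replicate_group (f := f) (s := s) ⟨_, p1, 1⟩ 1
    have F4 := fits_singleton (f := f) (s := s) ⟨1, one_pos, 0⟩ (0, 0)
    refine Fits.optCost_le hf (((((F1.append F2).append hF).append F3).append F4).mono
      fun i => ?_)
    obtain ⟨e, k⟩ := i
    have he : e = 0 ∨ e = 1 := by omega
    rcases he with rfl | rfl
    · have := hB0 k
      simp only [Fin.sum_univ_two, slowdown, zero_ne_one, if_false, if_true, procTime,
        Prod.mk.injEq, true_and]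
      split_ifs at this ⊢ <;> linarith
    · have := hB1 k
      simp only [Fin.sum_univ_two, slowdown, one_ne_zero, if_false, if_true,
        procTime, Prod.mk.injEq, false_and]
      linarith

end Climb

/-! ### The limit of `γ` tending to `s - 1`, and the two packings of the small jobs -/

section Limit

variable {f : ℕ} {s γ : ℝ} {A : OnlineAlg f}

/-- The odd climb jobs are exactly those that Greedy puts on the first group, so their slowed-down
sizes telescope to the rise of its level. The even ones do this for the second group, whose rise
also includes the initial gap but lacks the final `γ`. -/
theorem mul_sum_climbSize_odd (hs : 1 < s) (m : ℕ) :
    s * (∑ l ∈ Finset.range m, climbSize s γ (2 * l + 3) + climbSize s γ 1) =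
      ∑ k ∈ Finset.range (2 * m + 2), γ ^ (k + 1) := by
  induction m with
  | zero => simp [mul_climbSize hs, Finset.sum_range_succ]
  | succ m ih =>
    rw [Finset.sum_range_succ, show 2 * (m + 1) + 2 = 2 * m + 2 + 1 + 1 by ring,
      Finset.sum_range_succ, Finset.sum_range_succ, ← ih]
    have := mul_climbSize (γ := γ) hs (2 * m + 3)
    linear_combination this

theorem mul_sum_climbSize_even (hs : 1 < s) (m : ℕ) :
    s * ∑ l ∈ Finset.range m, climbSize s γ (2 * l + 2) + γ + γ ^ (2 * m + 2) =
      ∑ k ∈ Finset.range (2 * m + 2), γ ^ (k + 1) := by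
  induction m with
  | zero => simp [Finset.sum_range_succ]
  | succ m ih =>
    rw [Finset.sum_range_succ, show 2 * (m + 1) + 2 = 2 * m + 2 + 1 + 1 by ring,
      Finset.sum_range_succ, Finset.sum_range_succ, ← ih]
    have := mul_climbSize (γ := γ) hs (2 * m + 2)
    linear_combination this

theorem climbSize_sub_one (hs : 1 < s) (k : ℕ) : climbSize s (s - 1) k = (s - 1) ^ k := by
  have : s ≠ 0 := by linarith
  simp [climbSize, this]

/-- The load of the jobs from the climb, and of the final job, on machine `k` of the first group
in a good allocation. -/
noncomputable def climbLoad [NeZero f] (s γ : ℝ) (m : ℕ) (t : ℕ → Fin f) (k : Fin f) : ℝ :=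
  (if k = 0 then 1 else ∑ l ∈ Finset.range m, climbSize s γ (2 * l + 2)) +
    ∑ l ∈ Finset.range m, (if k = t l then climbSize s γ (2 * l + 2) else 0)

theorem sum_climbLoad [NeZero f] (m : ℕ) (t : ℕ → Fin f) :
    ∑ k, climbLoad s γ m t k =
      1 + f * ∑ l ∈ Finset.range m, climbSize s γ (2 * l + 2) := by
  obtain ⟨n, rfl⟩ : ∃ n, f = n + 1 := ⟨f - 1, by have := NeZero.ne f; omega⟩
  simp only [climbLoad]
  rw [Finset.sum_add_distrib, Finset.sum_comm, Fin.sum_univ_succ]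
  simp [Fin.succ_ne_zero]
  ring

theorem continuous_climbSize (k : ℕ) : Continuous fun γ => climbSize s γ k := by
  unfold climbSize
  fun_prop

theorem continuous_climbLoad [NeZero f] (m : ℕ) (t : ℕ → Fin f) (k : Fin f) :
    Continuous fun γ => climbLoad s γ m t k := by
  unfold climbLoad
  refine Continuous.add ?_ (continuous_finsetSum _ fun l _ => ?_)
  · split_ifs
    · exact continuous_const
    · exact continuous_finsetSum _ fun l _ => continuous_climbSize _
  · split_ifs
    · exact continuous_climbSize _
    · exact continuous_const

/-- The climb needs `γ > s - 1` strictly, but everything to be checked is continuous in `γ`, so it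
suffices to check it at `s - 1` and give away `η`. -/
theorem exists_ratio [NeZero f] (m : ℕ) (t : ℕ → Fin f) {h₁ η : ℝ} (hη : 0 < η)
    (hS : ∑ k ∈ Finset.range (2 * m + 2), (s - 1) ^ (k + 1) < h₁)
    (hb : ∀ k, climbLoad s (s - 1) m t k ≤ 1) :
    ∃ γ, s - 1 < γ ∧ γ < s - 1 + η ∧ ∑ k ∈ Finset.range (2 * m + 2), γ ^ (k + 1) < h₁ ∧
      ∑ k ∈ Finset.range (2 * m + 2), γ ^ (k + 1) <
        ∑ k ∈ Finset.range (2 * m + 2), (s - 1) ^ (k + 1) + η ∧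
      γ ^ (2 * m + 2) < (s - 1) ^ (2 * m + 2) + η ∧ ∀ k, climbLoad s γ m t k < 1 + η := by
  have hev : ∀ F : ℝ → ℝ, Continuous F → ∀ b, F (s - 1) < b →
      ∀ᶠ γ in nhdsWithin (s - 1) (Set.Ioi (s - 1)), F γ < b := fun F hF b hb =>
    (hF.continuousAt.eventually_lt_const hb).filter_mono nhdsWithin_le_nhds
  have hcS : Continuous fun γ : ℝ => ∑ k ∈ Finset.range (2 * m + 2), γ ^ (k + 1) := by fun_prop
  have H := (hev (fun γ => γ) continuous_id (s - 1 + η) (by linarith)).and <|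
    (hev _ hcS h₁ hS).and <| (hev _ hcS _ (lt_add_of_pos_right _ hη)).and <|
    (hev (fun γ => γ ^ (2 * m + 2)) (by fun_prop) _ (lt_add_of_pos_right _ hη)).and <|
    Filter.eventually_all.2 fun k => hev _ (continuous_climbLoad (s := s) m t k) (1 + η)
      ((hb k).trans_lt (by linarith))
  obtain ⟨γ, h1, h2⟩ := (H.and self_mem_nhdsWithin).exists
  exact ⟨γ, h2, h1⟩

/-- The optimum processes the jobs of the second group on their favorite machines, and some small
jobs of the first group on the wrong ones. -/
theorem IsGreedy.exists_jobs_of_few [NeZero f] (hs : 1 < s) (hs2 : s < 2) (hA : IsGreedy s A)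
    (m : ℕ) (t : ℕ → Fin f) {h₁ η : ℝ} (hη : 0 < η)
    (hh₁ : h₁ * (f * (s + 1)) = (2 * f - 1) * s ^ 2)
    (hS : ∑ k ∈ Finset.range (2 * m + 2), (s - 1) ^ (k + 1) < h₁)
    (hb : ∀ k, climbLoad s (s - 1) m t k ≤ 1)
    (hle : h₁ / s + (s - 1) ^ (2 * m + 2) ≤ 1 + η) :
    ∃ I : List Job, I ≠ [] ∧ optCost f s I ≤ 1 + 5 * η ∧ h₁ + 1 - η ≤ A.cost s I := by
  have hs0 : 0 < s := by linarith
  have hf0 : (1 : ℝ) ≤ f := by exact_mod_cast Nat.one_le_iff_ne_zero.2 (NeZero.ne f)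
  obtain ⟨γ, hγ, hγη, hSγ, -, hgγ, hbγ⟩ := exists_ratio m t hη hS hb
  have hodd := mul_sum_climbSize_odd (γ := γ) hs m
  have heven := mul_sum_climbSize_even (γ := γ) hs m
  -- `S` is the part of the final level `h₁` of the first group that is due to the climb and the
  -- initial gap; the small jobs supply the rest `x`. `O` and `E` are the odd and even climb jobs
  -- per machine, and `y` is the small volume per machine and kind.
  set S := ∑ k ∈ Finset.range (2 * m + 2), γ ^ (k + 1) with hSdef
  set g := γ ^ (2 * m + 2) with hg
  set O := ∑ l ∈ Finset.range m, climbSize s γ (2 * l + 3) + climbSize s γ 1 with hO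
  set E := ∑ l ∈ Finset.range m, climbSize s γ (2 * l + 2) with hE
  obtain ⟨x, hx⟩ : ∃ x, x = h₁ - S := ⟨_, rfl⟩
  obtain ⟨y, hy⟩ : ∃ y, y = x / s := ⟨_, rfl⟩
  have hys : s * y = x := by rw [hy]; field_simp
  have hOy : O + y = h₁ / s := by
    rw [eq_div_iff hs0.ne']
    linear_combination hodd + hys + hx
  have hx0 : 0 < x := by linarith
  have hy0 : 0 < y := by rw [hy]; positivity
  have hcap1 : 0 ≤ 1 + 2 * η - O - g - y := by linarith
  obtain ⟨I, hI, hopt, hcost⟩ := hA.exists_jobs_of_cap hs hs2 hγ m hx0 t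
    (fun c i => if c = 0 then
      (if i.1 = 0 then 1 + 2 * η - climbLoad s γ m t i.2 else (1 + 2 * η - O - g - y) / s)
      else if i.1 = 0 then 0 else y + η) (B := 1 + 5 * η) hη (fun c i => by
        split_ifs
        · linarith [hbγ i.2]
        · positivity
        · exact le_rfl
        · linarith)
    (fun c => by
      rw [← hy, Fintype.sum_prod_type, Fin.sum_univ_two]
      have : c = 0 ∨ c = 1 := by omega
      rcases this with rfl | rfl
      · simp only [if_true, one_ne_zero, if_false, Finset.sum_sub_distrib, Finset.sum_const,
          Finset.card_univ, Fintype.card_fin, nsmul_eq_mul]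
        -- This is the bound on `s` times the first volume plus the second; by the choice of `h₁` it
        -- is tight at `γ = s - 1`, `η = 0`. The gap `g` cancels, so it need not be small here.
        rw [sum_climbLoad, ← hE, mul_div_assoc', ← sub_le_iff_le_add', le_div_iff₀ hs0]
        have e1 : h₁ * (f * (s + 1)) = s * ((s + 1) * (h₁ * f / s)) := by field_simp
        have e2 : s * (h₁ * f / s) = h₁ * f := by field_simp
        have e3 : (s + 1) * (h₁ * f / s) = (2 * f - 1) * s := by
          refine mul_left_cancel₀ hs0.ne' ?_
          rw [← e1, hh₁]
          ring
        have e4 : f * (O + y) = h₁ * f / s := by rw [hOy]; ring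
        have e5 : 0 ≤ f * (γ - (s - 1)) := mul_nonneg (by linarith) (by linarith)
        have e6 : s * η ≤ f * (s + 1) * (2 * η) := by
          have := mul_le_mul_of_nonneg_right hf0 (show 0 ≤ s * η by positivity)
          nlinarith [mul_pos (show (0 : ℝ) < f by linarith) hη]
        have e7 : (f : ℝ) * (s * E + γ + g) = f * S := by rw [heven]
        have e8 : (f : ℝ) * (s * y) = f * x := by rw [hys]
        have e9 : (f : ℝ) * x = f * h₁ - f * S := by rw [hx]; ring
        linarith
      · simp only [if_true, one_ne_zero, if_false, Finset.sum_const,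
          Finset.card_univ, Fintype.card_fin, nsmul_eq_mul]
        have := mul_le_mul_of_nonneg_right hf0 hη.le
        linarith)
    (fun k => by
      simp only [if_true, one_ne_zero, if_false]
      rw [← hE, climbLoad, ← hE]
      linarith)
    (fun k => by
      simp only [if_true, one_ne_zero, if_false]
      rw [← hO, mul_div_cancel₀ _ hs0.ne']
      linarith)
  exact ⟨I, hI, hopt, by linarith⟩

/-- The optimum processes the jobs of the first group on their favorite machines, and some small
jobs of the second group on the wrong ones. -/
theorem IsGreedy.exists_jobs_of_many [NeZero f] (hs : 1 < s) (hs2 : s < 2) (hA : IsGreedy s A)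
    (m : ℕ) (t : ℕ → Fin f) {h₁ η : ℝ} (hη : 0 < η)
    (hh₁ : f * h₁ * (s + 1) = (2 * f - 1) * s + f * (s - 1) * (s + 1))
    (hfs : (f : ℝ) ≤ (f - 1) * s)
    (hS : ∑ k ∈ Finset.range (2 * m + 2), (s - 1) ^ (k + 1) < h₁)
    (hSs : ∑ k ∈ Finset.range (2 * m + 2), (s - 1) ^ (k + 1) ≤ s)
    (hb : ∀ k, climbLoad s (s - 1) m t k ≤ 1)
    (hle : (s - 1) ^ (2 * m + 2) ≤ η) :
    ∃ I : List Job, I ≠ [] ∧ optCost f s I ≤ 1 + 5 * η ∧ h₁ + 1 - η ≤ A.cost s I := by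
  have hs0 : 0 < s := by linarith
  have hf0 : (1 : ℝ) ≤ f := by exact_mod_cast Nat.one_le_iff_ne_zero.2 (NeZero.ne f)
  obtain ⟨γ, hγ, hγη, hSγ, hSη, hgγ, hbγ⟩ := exists_ratio m t hη hS hb
  have hodd := mul_sum_climbSize_odd (γ := γ) hs m
  have heven := mul_sum_climbSize_even (γ := γ) hs m
  have hg0 : 0 < γ ^ (2 * m + 2) := pow_pos (by linarith) _
  set S := ∑ k ∈ Finset.range (2 * m + 2), γ ^ (k + 1) with hSdef
  set g := γ ^ (2 * m + 2) with hg
  set O := ∑ l ∈ Finset.range m, climbSize s γ (2 * l + 3) + climbSize s γ 1 with hO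
  set E := ∑ l ∈ Finset.range m, climbSize s γ (2 * l + 2) with hE
  obtain ⟨x, hx⟩ : ∃ x, x = h₁ - S := ⟨_, rfl⟩
  obtain ⟨y, hy⟩ : ∃ y, y = x / s := ⟨_, rfl⟩
  have hys : s * y = x := by rw [hy]; field_simp
  have hx0 : 0 < x := by linarith
  have hy0 : 0 < y := by rw [hy]; positivity
  have hO1 : O ≤ 1 + η := by
    refine le_of_mul_le_mul_left ?_ hs0
    nlinarith
  have hcap1 : 0 ≤ 1 + 4 * η - O - g := by linarith
  set R := f * (1 + 2 * η) - (1 + f * E) with hR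
  have hRsum : ∑ k, (1 + 2 * η - climbLoad s γ m t k) = R := by
    rw [Finset.sum_sub_distrib, sum_climbLoad, Finset.sum_const, Finset.card_univ,
      Fintype.card_fin, nsmul_eq_mul]
  have hfη : η ≤ f * η := le_mul_of_one_le_left hη.le hf0
  have hfE : f * (s * E) = f * (h₁ - x - γ - g) := by
    rw [show s * E = S - γ - g by linarith, hx]
    ring
  have hfh : f * h₁ ≤ (f - 1) * s + f * (s - 1) := by
    refine le_of_mul_le_mul_right ?_ (show (0 : ℝ) < s + 1 by linarith)
    rw [hh₁]
    nlinarith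
  have hfγ : f * (s - 1) ≤ f * γ := mul_le_mul_of_nonneg_left hγ.le (by linarith)
  have hfg : 0 ≤ f * g := by positivity
  -- All small jobs of the first group fit into the room `R` left on their favorite machines; this
  -- uses `f ≤ (f - 1) * s` through `hfh`.
  have hTR : f * y + η ≤ R := by
    refine le_of_mul_le_mul_left ?_ hs0
    have : s * R = s * f + 2 * (s * (f * η)) - s - f * (s * E) := by rw [hR]; ring
    rw [this, hfE]
    have e1 : s * (f * y + η) = f * x + s * η := by rw [← hys]; ring
    rw [e1]
    have e2 : s * η ≤ s * (f * η) := mul_le_mul_of_nonneg_left hfη hs0.le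
    have e3 : 0 ≤ s * (f * η) := by positivity
    nlinarith
  have hR0 : 0 < R := lt_of_lt_of_le (by positivity) hTR
  -- On every machine of the first group, the share `θ` of the free room goes to its own small jobs
  -- and the rest to misplaced ones of the second group.
  set θ := (f * y + η) / R with hθ
  have hθR : θ * R = f * y + η := div_mul_cancel₀ _ hR0.ne'
  have hθ0 : 0 ≤ θ := by positivity
  have hθ1 : θ ≤ 1 := (div_le_one hR0).2 hTR
  obtain ⟨I, hI, hopt, hcost⟩ := hA.exists_jobs_of_cap hs hs2 hγ m hx0 t
    (fun c i => if c = 0 then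
      (if i.1 = 0 then θ * (1 + 2 * η - climbLoad s γ m t i.2) else 0)
      else if i.1 = 0 then (1 - θ) / s * (1 + 2 * η - climbLoad s γ m t i.2)
        else 1 + 4 * η - O - g) (B := 1 + 5 * η) hη (fun c i => by
        have h0 : 0 ≤ 1 + 2 * η - climbLoad s γ m t i.2 := by linarith [hbγ i.2]
        split_ifs
        · exact mul_nonneg hθ0 h0
        · exact le_rfl
        · exact mul_nonneg (div_nonneg (by linarith) hs0.le) h0
        · exact hcap1)
    (fun c => by
      rw [← hy, Fintype.sum_prod_type, Fin.sum_univ_two]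
      have : c = 0 ∨ c = 1 := by omega
      rcases this with rfl | rfl
      · simp only [if_true, one_ne_zero, if_false, ← Finset.mul_sum, Finset.sum_const_zero]
        rw [hRsum, hθR, add_zero]
      · simp only [if_true, one_ne_zero, if_false, ← Finset.mul_sum, Finset.sum_const,
          Finset.card_univ, Fintype.card_fin, nsmul_eq_mul]
        rw [hRsum]
        have e1 : (1 - θ) / s * R = (R - (f * y + η)) / s := by rw [← hθR]; ring
        -- The bound on the first volume plus `s` times the second is now the tight one. The gap
        -- jobs enter it with a positive net weight, so `g` has to be negligible.
        rw [e1, ← sub_le_iff_le_add, le_div_iff₀ hs0]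
        have e2 : f * h₁ * (s + 1) = s * (f * h₁ + f * h₁ / s) := by field_simp
        have e3 : f * h₁ + f * h₁ / s = (2 * f - 1) + f * (s - 1) + f * (s - 1) / s := by
          refine mul_left_cancel₀ hs0.ne' ?_
          rw [← e2, hh₁]
          field_simp
          ring
        have e4 : f * E = f * h₁ / s - f * y - f * γ / s - f * g / s := by
          rw [hy]
          field_simp
          linear_combination heven + hx
        have e5 : f * (s - 1) / s ≤ f * γ / s := div_le_div_of_nonneg_right hfγ hs0.le
        have e6 : 0 ≤ f * g / s := by positivity
        have e7 : f * (s * O) = f * h₁ - f * (s * y) := by rw [hodd, hys, hx]; ring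
        have e8 : f * s * g ≤ f * s * (2 * η) :=
          mul_le_mul_of_nonneg_left (by linarith) (by positivity)
        have e9 : s * η ≤ s * (f * η) := mul_le_mul_of_nonneg_left hfη hs0.le
        have e10 : f * η ≤ s * (f * η) := le_mul_of_one_le_left (by positivity) hs.le
        linarith)
    (fun k => by
      simp only [if_true, one_ne_zero, if_false]
      rw [← hE]
      have e1 : s * ((1 - θ) / s * (1 + 2 * η - climbLoad s γ m t k)) =
        (1 - θ) * (1 + 2 * η - climbLoad s γ m t k) := by field_simp
      rw [e1]
      have e2 : climbLoad s γ m t k = (if k = 0 then 1 else E) +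
        ∑ l ∈ Finset.range m, (if k = t l then climbSize s γ (2 * l + 2) else 0) := rfl
      linarith)
    (fun k => by
      simp only [if_true, one_ne_zero, if_false]
      rw [← hO]
      linarith)
  exact ⟨I, hI, hopt, by linarith⟩

end Limit

/-! ### Which of the three terms is the minimum -/

section Bound

variable {s c : ℝ}

theorem one_add_mul_le_add_mul (hs : 1 ≤ s) (h : c * s ≤ s + 1) :
    1 + c * (s ^ 2 / (s + 1)) ≤ s + c * (s / (s + 1)) := by
  have e : s + c * (s / (s + 1)) - (1 + c * (s ^ 2 / (s + 1))) =
      (s - 1) * (s + 1 - c * s) / (s + 1) := by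
    field_simp
    ring
  have := div_nonneg (mul_nonneg (sub_nonneg.2 hs) (sub_nonneg.2 h)) (show 0 ≤ s + 1 by linarith)
  linarith

theorem add_mul_le_one_add_mul (hs : 1 ≤ s) (h : s + 1 ≤ c * s) :
    s + c * (s / (s + 1)) ≤ 1 + c * (s ^ 2 / (s + 1)) := by
  have e : 1 + c * (s ^ 2 / (s + 1)) - (s + c * (s / (s + 1))) =
      (s - 1) * (c * s - (s + 1)) / (s + 1) := by
    field_simp
    ring
  have := div_nonneg (mul_nonneg (sub_nonneg.2 hs) (sub_nonneg.2 h)) (show 0 ≤ s + 1 by linarith)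
  linarith

theorem one_add_mul_le_one_add (hs : 1 ≤ s) (hc : 0 ≤ c) (h : s ^ 2 ≤ s + 1) :
    1 + c * (s ^ 2 / (s + 1)) ≤ 1 + c := by
  have : s ^ 2 / (s + 1) ≤ 1 := (div_le_one (by linarith)).2 h
  linarith [mul_le_mul_of_nonneg_left this hc]

theorem one_add_le_one_add_mul (hs : 1 ≤ s) (hc : 0 ≤ c) (h : s + 1 ≤ s ^ 2) :
    1 + c ≤ 1 + c * (s ^ 2 / (s + 1)) := by
  have : 1 ≤ s ^ 2 / (s + 1) := (one_le_div (by linarith)).2 h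
  linarith [mul_le_mul_of_nonneg_left this hc]

theorem add_mul_le_one_add (hs : 1 ≤ s) (h : s ^ 2 - 1 ≤ c) :
    s + c * (s / (s + 1)) ≤ 1 + c := by
  have e : 1 + c - (s + c * (s / (s + 1))) = (c - (s ^ 2 - 1)) / (s + 1) := by
    field_simp
    ring
  have := div_nonneg (sub_nonneg.2 h) (show 0 ≤ s + 1 by linarith)
  linarith

theorem one_add_le_add_mul (hs : 1 ≤ s) (h : c ≤ s ^ 2 - 1) :
    1 + c ≤ s + c * (s / (s + 1)) := by
  have e : s + c * (s / (s + 1)) - (1 + c) = (s ^ 2 - 1 - c) / (s + 1) := by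
    field_simp
    ring
  have := div_nonneg (sub_nonneg.2 h) (show 0 ≤ s + 1 by linarith)
  linarith

end Bound

section Value

variable {f : ℕ} {s : ℝ}

theorem three_sub_eq : 3 - 1 / (f : ℝ) = 1 + (2 - 1 / (f : ℝ)) := by ring

theorem one_le_two_sub (hf : 1 ≤ f) : 1 ≤ 2 - 1 / (f : ℝ) := by
  have hf0 : (1 : ℝ) ≤ f := by exact_mod_cast hf
  have : 1 / (f : ℝ) ≤ 1 := by rw [div_le_one] <;> linarith
  linarith

theorem greedyBound_eq_fst (hf : 1 ≤ f) (hs : 1 ≤ s) (h1 : (2 - 1 / (f : ℝ)) * s ≤ s + 1)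
    (h2 : s ^ 2 ≤ s + 1) :
    greedyBound f s = 1 + (2 - 1 / (f : ℝ)) * (s ^ 2 / (s + 1)) := by
  have hc := one_le_two_sub hf
  rw [greedyBound, three_sub_eq, min_eq_left (one_add_mul_le_add_mul hs h1),
    min_eq_left (one_add_mul_le_one_add hs (by linarith) h2)]

theorem greedyBound_eq_snd (hs : 1 ≤ s) (h1 : s + 1 ≤ (2 - 1 / (f : ℝ)) * s)
    (h2 : s ^ 2 - 1 ≤ 2 - 1 / (f : ℝ)) :
    greedyBound f s = s + (2 - 1 / (f : ℝ)) * (s / (s + 1)) := by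
  rw [greedyBound, three_sub_eq, min_eq_right (add_mul_le_one_add_mul hs h1),
    min_eq_left (add_mul_le_one_add hs h2)]

theorem greedyBound_eq_trd (hf : 1 ≤ f) (hs : 1 ≤ s) (h1 : s + 1 ≤ s ^ 2)
    (h2 : 2 - 1 / (f : ℝ) ≤ s ^ 2 - 1) : greedyBound f s = 3 - 1 / (f : ℝ) := by
  have hc := one_le_two_sub hf
  rw [greedyBound, three_sub_eq]
  exact min_eq_right (le_min (one_add_le_one_add_mul hs (by linarith) h1) (one_add_le_add_mul hs h2))

end Value

/-! ### Geometric sums and the packing of the climb jobs -/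

section Geometric

variable {f : ℕ} {s : ℝ}

theorem sum_pow_succ_lt {r : ℝ} (h0 : 0 < r) (h1 : r < 1) (n : ℕ) :
    ∑ k ∈ Finset.range n, r ^ (k + 1) < r / (1 - r) := by
  have h := geom_sum_mul_neg r n
  have hp : 0 < r ^ n := pow_pos h0 n
  simp only [pow_succ', ← Finset.mul_sum]
  refine (mul_lt_mul_of_pos_left ?_ h0).trans_eq (mul_one_div r (1 - r))
  rw [lt_div_iff₀ (by linarith), h]
  linarith

theorem climbLoad_sub_one [NeZero f] (hs : 1 < s) (m : ℕ) (t : ℕ → Fin f) (k : Fin f) :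
    climbLoad s (s - 1) m t k =
      (if k = 0 then 1 else ∑ l ∈ Finset.range m, ((s - 1) ^ 2) ^ (l + 1)) +
        ∑ l ∈ Finset.range m, (if k = t l then ((s - 1) ^ 2) ^ (l + 1) else 0) := by
  simp only [climbLoad, climbSize_sub_one hs, ← pow_mul, mul_add, mul_one]

/-- For at least three machines in each group, the jobs from the climb can be packed. -/
theorem climbLoad_le_one [NeZero f] (hf : 3 ≤ f) (hs : 1 < s) (hs1 : s ^ 2 ≤ s + 1) {m : ℕ}
    (hm : 0 < m) (k : Fin f) :
    climbLoad s (s - 1) m (fun l => if l = 0 then ⟨1, by omega⟩ else ⟨2, by omega⟩) k ≤ 1 := by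
  rw [climbLoad_sub_one hs]
  obtain ⟨q, hq⟩ : ∃ q, q = (s - 1) ^ 2 := ⟨_, rfl⟩
  rw [← hq]
  have hs2 : s < 1.62 := by nlinarith
  have hq0 : 0 < q := by rw [hq]; exact pow_pos (by linarith) 2
  have hq1 : q < 1 / 2 := by rw [hq]; nlinarith
  -- Since `E < q / (1 - q)`, this is what `E + q ≤ 1` requires. With `r = s - 1`, the left factor
  -- below is `1 - r - r ^ 2`, nonnegative precisely because `s ^ 2 ≤ s + 1`.
  have hq3 : q * (3 - q) ≤ 1 := by
    have h2 : (1 - (s - 1) ^ 2 - (s - 1)) * (1 - (s - 1) ^ 2 + (s - 1)) =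
      1 - q * (3 - q) := by rw [hq]; ring
    have h3 : 0 ≤ (1 - (s - 1) ^ 2 - (s - 1)) * (1 - (s - 1) ^ 2 + (s - 1)) :=
      mul_nonneg (by nlinarith) (by nlinarith)
    linarith
  have hE := sum_pow_succ_lt hq0 (by linarith) m
  set E := ∑ l ∈ Finset.range m, q ^ (l + 1) with hEdef
  have hE' : E * (1 - q) < q := (lt_div_iff₀ (by linarith)).1 hE
  have hE0 : E < 1 := by nlinarith
  have hEq : E + q ≤ 1 := by
    refine le_of_mul_le_mul_right ?_ (show 0 < 1 - q by linarith)
    nlinarith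
  have h2E : 2 * E - q ≤ 1 := by
    refine le_of_mul_le_mul_right ?_ (show 0 < 1 - q by linarith)
    nlinarith
  have hsum : ∑ l ∈ Finset.range m, (if l = 0 then q else 0) = q := by
    rw [Finset.sum_ite_eq' (Finset.range m) 0 fun _ => q, if_pos (Finset.mem_range.2 hm)]
  have h10 : (⟨1, by omega⟩ : Fin f) ≠ 0 := by simp [Fin.ext_iff]
  have h20 : (⟨2, by omega⟩ : Fin f) ≠ 0 := by simp [Fin.ext_iff]
  -- Of the jobs moved away from machine `0`, the largest, of size `q`, goes to machine `1`, and all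
  -- others, of total size `E - q`, to machine `2`.
  by_cases h1 : k = ⟨1, by omega⟩
  · subst h1
    rw [if_neg h10]
    refine le_trans (add_le_add le_rfl ?_) hEq
    refine (Finset.sum_le_sum fun l _ => ?_).trans_eq hsum
    rcases Nat.eq_zero_or_pos l with rfl | hl
    · simp
    · simp [hl.ne']
  by_cases h2 : k = ⟨2, by omega⟩
  · subst h2
    rw [if_neg h20]
    have e : E - q = ∑ l ∈ Finset.range m, (q ^ (l + 1) - if l = 0 then q else 0) := by
      rw [Finset.sum_sub_distrib, hsum]
    have : ∑ l ∈ Finset.range m, (if (⟨2, by omega⟩ : Fin f) =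
        (if l = 0 then ⟨1, by omega⟩ else ⟨2, by omega⟩) then q ^ (l + 1) else 0) ≤ E - q := by
      rw [e]
      refine Finset.sum_le_sum fun l _ => ?_
      rcases Nat.eq_zero_or_pos l with rfl | hl
      · simp
      · simp [hl.ne']
    linarith
  · rw [Finset.sum_eq_zero fun l _ => ?_, add_zero]
    · split_ifs <;> linarith
    · rcases Nat.eq_zero_or_pos l with rfl | hl
      · simp [h1]
      · simp [hl.ne', h2]

theorem exists_pow_le {r η : ℝ} (h0 : 0 < r) (h1 : r < 1) (hη : 0 < η) :
    ∃ m : ℕ, 0 < m ∧ r ^ (2 * m + 2) ≤ η := by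
  obtain ⟨n, hn⟩ := exists_pow_lt_of_lt_one hη h1
  exact ⟨n + 1, n.succ_pos, (pow_le_pow_of_le_one h0.le h1.le (by omega)).trans hn.le⟩

end Geometric

/-! ### The competitive ratio in each range of parameters -/

section Cases

variable {f : ℕ} {s : ℝ} {A : OnlineAlg f}

theorem IsGreedy.hasCompetitiveRatio_of_eq_one (hf : 1 ≤ f) (hA : IsGreedy 1 A) :
    HasCompetitiveRatio 1 A (greedyBound f 1) := by
  refine hA.hasCompetitiveRatio hf le_rfl fun η hη => ?_
  obtain ⟨I, hI, h1, h2⟩ := hA.exists_jobs_of_eq_one hf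
  refine ⟨I, hI, by linarith, ?_⟩
  have h3 : greedyBound f 1 ≤ 1 + (2 - 1 / (f : ℝ)) * (1 ^ 2 / (1 + 1)) :=
    (min_le_left _ _).trans (min_le_left _ _)
  linarith

theorem exists_lt_mul_sub_le {b s η : ℝ} (hb : 0 < b) (hs : 0 < s) (hη : 0 < η) :
    ∃ q, 0 < q ∧ q < b ∧ s * (b - q) ≤ η := by
  refine ⟨b - min (b / 2) (η / s), ?_, ?_, ?_⟩
  · have := min_le_left (b / 2) (η / s)
    linarith
  · have : 0 < min (b / 2) (η / s) := lt_min (by positivity) (by positivity)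
    linarith
  · have := mul_le_mul_of_nonneg_left (min_le_right (b / 2) (η / s)) hs.le
    rw [mul_div_cancel₀ _ hs.ne'] at this
    linarith

/-- Two sizes `a = 1 - 1 / s` and `q` just below `1 / s` lift the first group to nearly `1` before
the jobs of size `1 / f`. The final job then costs nearly `3 - 1 / f` there and `s + 1 - 1 / s` on
the second group, which `hsc` makes no smaller. -/
theorem IsGreedy.hasCompetitiveRatio_of_lt (hf : 1 ≤ f) (hs : 1 < s) (hA : IsGreedy s A)
    (hsc : (2 - 1 / (f : ℝ)) * s ≤ s ^ 2 - 1)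
    (hsf : (f : ℝ) < s ∨ f = 1) :
    HasCompetitiveRatio s A (greedyBound f s) := by
  have hs0 : 0 < s := by linarith
  have hf0 : (1 : ℝ) ≤ f := by exact_mod_cast hf
  refine hA.hasCompetitiveRatio hf hs.le fun η hη => ?_
  have ha : 0 < 1 - 1 / s := by rw [sub_pos, div_lt_one hs0]; exact hs
  obtain ⟨q, hq0, hq1, hqη⟩ := exists_lt_mul_sub_le (one_div_pos.2 hs0) hs0 hη
  have e1 : s * (1 / s) = 1 := by field_simp
  obtain ⟨I, hI, hopt, hcost⟩ := hA.exists_jobs_of_two_sizes hf hs ha hq0 (by linarith)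
    (by nlinarith) (by
      refine hsf.imp (fun hsf => ?_) id
      have h1 : s * q < 1 := by nlinarith
      have h2 : 1 + (1 - 1 / (f : ℝ)) ≤ 1 - 1 / s + s / f := by
        have h3 : (s + 1) / s ≤ (s + 1) / f :=
          div_le_div_of_nonneg_left (by linarith) (by linarith) hsf.le
        rw [add_div, div_self hs0.ne', add_div] at h3
        linarith
      linarith)
  refine ⟨I, hI, by linarith, le_trans ?_ hcost⟩
  have h3 : greedyBound f s ≤ 3 - 1 / (f : ℝ) := min_le_right _ _
  refine le_min (by linarith) ?_
  have h4 : 2 - 1 / (f : ℝ) ≤ s - 1 / s := by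
    rw [show s - 1 / s = (s ^ 2 - 1) / s by field_simp, le_div_iff₀ hs0]
    exact hsc
  linarith

theorem IsGreedy.hasCompetitiveRatio_of_single (hs : 1 < s) {A : OnlineAlg 1}
    (hA : IsGreedy s A) (hs1 : s ^ 2 ≤ s + 1) : HasCompetitiveRatio s A (greedyBound 1 s) := by
  have hs0 : 0 < s := by linarith
  refine hA.hasCompetitiveRatio le_rfl hs.le fun η hη => ?_
  obtain ⟨q, hq0, hq1, hqη⟩ := exists_lt_mul_sub_le (b := s / (s + 1)) (by positivity) hs0 hη
  have e1 : s / (s + 1) + 1 / (s + 1) = 1 := by field_simp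
  have e2 : s * (s / (s + 1)) = s ^ 2 / (s + 1) := by ring
  have e3 : s ^ 2 / (s + 1) ≤ 1 := (div_le_one (by linarith)).2 hs1
  -- With `a = 1 / (s + 1)` and `q` close to `s / (s + 1)`, the final job is balanced between the
  -- two machines.
  have e4 : s ^ 2 / (s + 1) + 1 = 1 / (s + 1) + s := by
    field_simp
    ring
  obtain ⟨I, hI, hopt, hcost⟩ := hA.exists_jobs_of_two_sizes le_rfl hs
    (show 0 < 1 / (s + 1) by positivity) hq0 (by linarith) (by nlinarith) (Or.inr rfl)
  refine ⟨I, hI, by linarith, le_trans ?_ hcost⟩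
  have h3 : greedyBound 1 s ≤ 1 + (2 - 1 / ((1 : ℕ) : ℝ)) * (s ^ 2 / (s + 1)) :=
    (min_le_left _ _).trans (min_le_left _ _)
  rw [show 2 - 1 / ((1 : ℕ) : ℝ) = 1 by norm_num] at h3 ⊢
  exact le_min (by linarith) (by linarith)

theorem IsGreedy.hasCompetitiveRatio_of_two (hs : 1 < s) {A : OnlineAlg 2}
    (hA : IsGreedy s A) (hs1 : s ≤ 1.605) : HasCompetitiveRatio s A (greedyBound 2 s) := by
  have hs0 : 0 < s := by linarith
  refine hA.hasCompetitiveRatio (by norm_num) hs.le fun η hη => ?_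
  obtain ⟨r, hr⟩ : ∃ r, r = s - 1 := ⟨_, rfl⟩
  have hr0 : 0 < r := by linarith
  have hr1 : r ≤ 0.605 := by norm_num at hs1 ⊢; linarith
  have hsr : s = r + 1 := by linarith
  have hp : ∀ n : ℕ, r ^ (n + 1) ≤ 0.605 ^ n * r := fun n => by
    rw [pow_succ]
    exact mul_le_mul_of_nonneg_right (pow_le_pow_left₀ hr0.le hr1 n) hr0.le
  have p2 := hp 1
  have p3 := hp 2
  have p4 := hp 3
  have p5 := hp 4
  have p6 := hp 5
  have p7 := hp 6
  norm_num at p2 p3 p4 p5 p6 p7 hr1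
  -- Only machine `1` can take the moved jobs, so with two rounds and `q = r ^ 2` the packing needs
  -- `2 * (q + q ^ 2) ≤ 1`; this is where `1.605` comes from. The initial gap `r ^ 6` is not small,
  -- but still fits.
  obtain ⟨I, hI, hopt, hcost⟩ := hA.exists_jobs_of_few hs (by linarith) 2 (fun _ => 1)
    (h₁ := 3 * s ^ 2 / (2 * (s + 1))) (show 0 < η / 5 by positivity)
    (by push_cast; field_simp; ring)
    (by
      rw [← hr, hsr, lt_div_iff₀ (by linarith)]
      simp only [Finset.sum_range_succ, Finset.sum_range_zero]
      norm_num
      nlinarith)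
    (fun k => by
      rw [climbLoad_sub_one hs, ← hr]
      simp only [Finset.sum_range_succ, Finset.sum_range_zero]
      fin_cases k
      · simp
      · simp
        nlinarith)
    (by
      rw [← hr, hsr, show 3 * (r + 1) ^ 2 / (2 * (r + 1 + 1)) / (r + 1) =
        3 * (r + 1) / (2 * (r + 1 + 1)) by field_simp]
      have : 3 * (r + 1) / (2 * (r + 1 + 1)) ≤ 1 - r ^ 6 := by
        rw [div_le_iff₀ (by linarith)]
        nlinarith
      norm_num
      linarith)
  refine ⟨I, hI, by linarith, ?_⟩
  have h3 : greedyBound 2 s ≤ 1 + (2 - 1 / ((2 : ℕ) : ℝ)) * (s ^ 2 / (s + 1)) :=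
    (min_le_left _ _).trans (min_le_left _ _)
  have h4 : (2 - 1 / ((2 : ℕ) : ℝ)) * (s ^ 2 / (s + 1)) = 3 * s ^ 2 / (2 * (s + 1)) := by
    push_cast
    field_simp
    norm_num
  linarith

theorem two_sub_ge (hf : 3 ≤ f) : 5 / 3 ≤ 2 - 1 / (f : ℝ) := by
  have hf0 : (3 : ℝ) ≤ f := by exact_mod_cast hf
  have : 1 / (f : ℝ) ≤ 1 / 3 := one_div_le_one_div_of_le (by norm_num) hf0
  linarith

theorem IsGreedy.hasCompetitiveRatio_of_few (hf : 3 ≤ f) (hs : 1 < s) (hA : IsGreedy s A)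
    (hs1 : s ≤ 1.5) (hfs : (f - 1) * s ≤ (f : ℝ)) :
    HasCompetitiveRatio s A (greedyBound f s) := by
  have hs0 : 0 < s := by linarith
  have : NeZero f := ⟨by omega⟩
  have hf0 : (3 : ℝ) ≤ f := by exact_mod_cast hf
  have hc := two_sub_ge hf
  norm_num at hs1
  refine hA.hasCompetitiveRatio (by omega) hs.le fun η hη => ?_
  obtain ⟨m, hm, hmη⟩ := exists_pow_le (show 0 < s - 1 by linarith) (by linarith)
    (show 0 < η / 5 by positivity)
  -- The jobs of the second group, apart from the initial gap, fit on their favorite machines; this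
  -- is equivalent to `hfs`.
  have e1 : (2 - 1 / (f : ℝ)) * (s ^ 2 / (s + 1)) / s ≤ 1 := by
    rw [show (2 - 1 / (f : ℝ)) * (s ^ 2 / (s + 1)) / s = (2 * f - 1) * s / (f * (s + 1)) by
      field_simp, div_le_one (by positivity)]
    linarith
  obtain ⟨I, hI, hopt, hcost⟩ := hA.exists_jobs_of_few hs (by linarith) m _
    (h₁ := (2 - 1 / (f : ℝ)) * (s ^ 2 / (s + 1))) (show 0 < η / 5 by positivity)
    (by field_simp)
    (by
      refine (sum_pow_succ_lt (by linarith) (by linarith) _).trans_le ?_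
      refine le_trans ?_ (mul_le_mul_of_nonneg_right hc (by positivity))
      rw [mul_div_assoc', div_le_div_iff₀ (by linarith) (by linarith)]
      nlinarith)
    (climbLoad_le_one hf hs (by nlinarith) hm) (by linarith)
  refine ⟨I, hI, by linarith, ?_⟩
  have h3 : greedyBound f s ≤ 1 + (2 - 1 / (f : ℝ)) * (s ^ 2 / (s + 1)) :=
    (min_le_left _ _).trans (min_le_left _ _)
  linarith

theorem IsGreedy.hasCompetitiveRatio_of_many (hf : 3 ≤ f) (hs : 1 < s) (hA : IsGreedy s A)
    (hs1 : s ^ 2 ≤ s + 1) (hfs : (f : ℝ) ≤ (f - 1) * s) :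
    HasCompetitiveRatio s A (greedyBound f s) := by
  have hs0 : 0 < s := by linarith
  have : NeZero f := ⟨by omega⟩
  have hf0 : (3 : ℝ) ≤ f := by exact_mod_cast hf
  have hc := two_sub_ge hf
  have hs2 : s < 1.62 := by nlinarith
  norm_num at hs2
  refine hA.hasCompetitiveRatio (by omega) hs.le fun η hη => ?_
  obtain ⟨m, hm, hmη⟩ := exists_pow_le (show 0 < s - 1 by linarith) (by linarith)
    (show 0 < η / 5 by positivity)
  have hlt := sum_pow_succ_lt (r := s - 1) (by linarith) (by linarith) (2 * m + 2)
  obtain ⟨I, hI, hopt, hcost⟩ := hA.exists_jobs_of_many hs (by linarith) m _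
    (h₁ := (2 - 1 / (f : ℝ)) * (s / (s + 1)) + (s - 1)) (show 0 < η / 5 by positivity)
    (by field_simp) hfs
    (by
      refine hlt.trans_le ?_
      refine le_trans ?_ (add_le_add (mul_le_mul_of_nonneg_right hc
        (show 0 ≤ s / (s + 1) by positivity)) le_rfl)
      rw [← sub_le_iff_le_add, show (s - 1) / (1 - (s - 1)) - (s - 1) =
        (s - 1) ^ 2 / (1 - (s - 1)) by
          have : 1 - (s - 1) ≠ 0 := by linarith
          field_simp
          ring, mul_div_assoc', div_le_div_iff₀ (by linarith) (by linarith)]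
      nlinarith)
    (hlt.le.trans (by
      rw [div_le_iff₀ (by linarith)]
      nlinarith))
    (climbLoad_le_one hf hs hs1 hm) hmη
  refine ⟨I, hI, by linarith, ?_⟩
  have h3 : greedyBound f s ≤ s + (2 - 1 / (f : ℝ)) * (s / (s + 1)) :=
    (min_le_left _ _).trans (min_le_right _ _)
  linarith

end Cases

end SymmetricFavorite

/-! ### Assembling the five cases -/

theorem theorem6 (f : ℕ) (s : ℝ) (hs : 1 ≤ s)
    (A : SymmetricFavorite.OnlineAlg f) (hA : SymmetricFavorite.IsGreedy s A) :
    (f = 1 →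
      SymmetricFavorite.HasCompetitiveRatio s A (SymmetricFavorite.greedyBound f s) ∧
      SymmetricFavorite.greedyBound f s = min (1 + s ^ 2 / (s + 1)) 2) ∧
    (f = 2 → s ≤ 1.605 →
      SymmetricFavorite.HasCompetitiveRatio s A (SymmetricFavorite.greedyBound f s) ∧
      SymmetricFavorite.greedyBound f s = 1 + 3 * s ^ 2 / (2 * (s + 1))) ∧
    (3 ≤ f → (s = 1 ∨ (f : ℝ) ≤ s / (s - 1)) →
      s ≤ 1.5 ∧
      SymmetricFavorite.HasCompetitiveRatio s A (SymmetricFavorite.greedyBound f s) ∧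
      SymmetricFavorite.greedyBound f s = 1 + (2 - 1 / (f : ℝ)) * (s ^ 2 / (s + 1))) ∧
    (1 < s → s / (s - 1) < (f : ℝ) → s ≤ (1 + Real.sqrt 5) / 2 →
      SymmetricFavorite.HasCompetitiveRatio s A (SymmetricFavorite.greedyBound f s) ∧
      SymmetricFavorite.greedyBound f s = s + (2 - 1 / (f : ℝ)) * (s / (s + 1))) ∧
    (2 ≤ f → (f : ℝ) < s →
      SymmetricFavorite.HasCompetitiveRatio s A (SymmetricFavorite.greedyBound f s) ∧
      SymmetricFavorite.greedyBound f s = 3 - 1 / (f : ℝ)) := by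
  have hs0 : 0 < s := by linarith
  refine ⟨?_, ?_, ?_, ?_, ?_⟩
  · rintro rfl
    constructor
    · rcases hs.eq_or_lt with rfl | hs1
      · exact hA.hasCompetitiveRatio_of_eq_one le_rfl
      rcases le_total (s ^ 2) (s + 1) with h | h
      · exact hA.hasCompetitiveRatio_of_single hs1 h
      · exact hA.hasCompetitiveRatio_of_lt le_rfl hs1 (by norm_num; linarith) (Or.inr rfl)
    · have h := SymmetricFavorite.one_add_mul_le_add_mul (c := 1) hs (by linarith)
      rw [one_mul, one_mul] at h
      rw [SymmetricFavorite.greedyBound, show 2 - 1 / ((1 : ℕ) : ℝ) = 1 by norm_num,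
        show 3 - 1 / ((1 : ℕ) : ℝ) = 2 by norm_num, one_mul, one_mul, min_eq_left h]
  · rintro rfl hs1
    norm_num at hs1
    refine ⟨?_, ?_⟩
    · rcases hs.eq_or_lt with rfl | hs2
      · exact hA.hasCompetitiveRatio_of_eq_one (by norm_num)
      · exact hA.hasCompetitiveRatio_of_two hs2 (by norm_num; exact hs1)
    · rw [SymmetricFavorite.greedyBound_eq_fst (by norm_num) hs (by norm_num; linarith) (by nlinarith)]
      push_cast
      field_simp
      ring
  · intro hf h
    have hf0 : (3 : ℝ) ≤ f := by exact_mod_cast hf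
    have hfs : (f - 1) * s ≤ (f : ℝ) := by
      rcases hs.eq_or_lt with rfl | hs1
      · linarith
      · have := h.resolve_left hs1.ne'
        rw [le_div_iff₀ (by linarith)] at this
        linarith
    have hs1 : s ≤ 3 / 2 := by nlinarith
    have hc := SymmetricFavorite.one_le_two_sub (f := f) (by omega)
    refine ⟨by norm_num; exact hs1, ?_,
      SymmetricFavorite.greedyBound_eq_fst (by omega) hs ?_ (by nlinarith)⟩
    · rcases hs.eq_or_lt with rfl | hs2
      · exact hA.hasCompetitiveRatio_of_eq_one (by omega)
      · exact hA.hasCompetitiveRatio_of_few hf hs2 (by norm_num; exact hs1) hfs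
    · rw [show (2 - 1 / (f : ℝ)) * s = (2 * f - 1) * s / f by field_simp,
        div_le_iff₀ (by linarith)]
      linarith
  · intro hs1 h1 h2
    have h5 : Real.sqrt 5 ^ 2 = 5 := Real.sq_sqrt (by norm_num)
    have hsq : s ^ 2 ≤ s + 1 := by nlinarith [Real.sqrt_nonneg 5]
    rw [div_lt_iff₀ (by linarith)] at h1
    have hs2 : s < 1.62 := by nlinarith
    norm_num at hs2
    -- For `s < 1.62` the quotient `s / (s - 1)` exceeds `2`.
    have hf : 3 ≤ f := by
      by_contra! hlt
      have : (f : ℝ) ≤ 2 := by exact_mod_cast Nat.le_of_lt_succ hlt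
      nlinarith
    have hf0 : (3 : ℝ) ≤ f := by exact_mod_cast hf
    have hc := SymmetricFavorite.two_sub_ge hf
    refine ⟨hA.hasCompetitiveRatio_of_many hf hs1 hsq (by linarith),
      SymmetricFavorite.greedyBound_eq_snd hs ?_ (by linarith)⟩
    rw [show (2 - 1 / (f : ℝ)) * s = (2 * f - 1) * s / f by field_simp,
      le_div_iff₀ (by linarith)]
    linarith
  · intro hf hfs
    have hf0 : (2 : ℝ) ≤ f := by exact_mod_cast hf
    have hs1 : 1 < s := by linarith
    have h1 : (2 - 1 / (f : ℝ)) * s ≤ s ^ 2 - 1 := by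
      have : 1 ≤ s / f := (one_le_div (by linarith)).2 hfs.le
      rw [sub_mul, one_div_mul_eq_div]
      nlinarith
    have hc := SymmetricFavorite.one_le_two_sub (f := f) (by omega)
    exact ⟨hA.hasCompetitiveRatio_of_lt (by omega) hs1 h1 (Or.inl hfs),
      SymmetricFavorite.greedyBound_eq_trd (by omega) hs (by nlinarith) (by nlinarith)⟩
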